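/- **Setting.** Let $K,T\ge 1$ be integers, $\mathcal X$ a context space, $\mathcal F\subseteq([0,1])^{\mathcal X\times[K]}$ and $\mathcal G\subseteq([0,1])^{\mathcal X\times[K]\times[K]}$. In round $t=1,\dots,T$ a possibly randomised and adaptive environment selects a context $x_t\in\mathcal X$, a loss vector $\ell_t\in[0,1]^K$ and a directed graph $G_t=([K],E_t)$, self-loops allowed, which is strongly observable: for each node $i$, either $(i,i)\in E_t$ or $(j,i)\in E_t$ for all $j\ne i$. The learner sees $x_t$, draws $i_t\sim p_t$, and then observes exactly $A_t=\{j:(i_t,j)\in E_t\}$ and $\ell_{t,j}$ for $j\in A_t$ (partially revealed graphs). Let $\mathcal H_t$ be the information available just before $\ell_t,G_t,i_t$ are drawn; it contains the past and $x_t$, and determines $p_t$. Given $\mathcal H_t$, $\ell_t$ and $G_t$, the action $i_t$ has distribution $p_t$. **Independence numbers.** $\alpha(G)$ is the largest size of a set of nodes no two distinct members of which are joined by an edge in either direction. For $g:\mathcal X\times[K]\times[K]\to[0,1]$ let $\mathcal Q(g,x)$ be the set of distributions on strongly observable graphs under which each edge $(i,j)$ has probability $g(x,i,j)$. Put $\alpha(g,x)=\inf_{q\in\mathcal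 Q(g,x)}\mathbb E_{G\sim q}[\alpha(G)]$ and $\alpha(\mathcal G)=\sup_{g\in\mathcal G,\,x\in\mathcal X}\alpha(g,x)$. Assume $\mathcal Q(g,x)\neq\emptyset$ for all $g\in\mathcal G$, $x\in\mathcal X$. **Assumptions.** 1. (Realizability) There are $f^\star\in\mathcal F$ and $g^\star\in\mathcal G$ with $\mathbb E[\ell_{t,i}\mid\mathcal H_t]=f^\star(x_t,i)$ and $\Pr[(i,j)\in E_t\mid\mathcal H_t]=g^\star(x_t,i,j)$ for all $t,i,j$. Moreover, given $\mathcal H_t$, the variables $\mathbf 1\{(i,j)\in E_t\}$ and $\ell_{t,j}$ are uncorrelated for all $t,i,j$. 2. (Squared-loss oracle) In round $t$ an online oracle outputs $f_t\in\mathrm{conv}(\mathcal F)$, and almost surely $$\sum_{t=1}^T\sum_{j\in A_t}(f_t(x_t,j)-\ell_{t,j})^2-\inf_{f\in\mathcal F}\sum_{t=1}^T\sum_{j\in A_t}(f(x_t,j)-\ell_{t,j})^2\le \mathrm{Reg}_{\mathsf{Sq}}.$$ 3. (Log-loss oracle) In round $t$ an online oracle outputs $g_t\in\mathrm{conv}(\mathcal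 G)$, and almost surely, with $b_{t,j}=\mathbf 1\{j\in A_t\}$ and $\ell_{\log}(u,v)=v\log\frac1u+(1-v)\log\frac1{1-u}\in[0,\infty]$ (where $0\cdot\infty=0$), $$\sum_{t=1}^T\sum_{j=1}^K\ell_{\log}(g_t(x_t,i_t,j),b_{t,j})\le\inf_{g\in\mathcal G}\sum_{t=1}^T\sum_{j=1}^K\ell_{\log}(g(x_t,i_t,j),b_{t,j})+\max\{\mathrm{Reg}_{\mathsf{Log}},0\}.$$ The values $f_t(x_t,\cdot)$ and $g_t(x_t,\cdot,\cdot)$ are $\mathcal H_t$-measurable. Write $R=\max\{\mathrm{Reg}_{\mathsf{Sq}},\mathrm{Reg}_{\mathsf{Log}}\}$ and assume $R>0$. **Algorithm.** SquareCB.UG with parameter $\gamma$ plays some $p_t\in\operatorname{argmin}_{p\in\Delta([K])}\mathsf{dec}_\gamma(p;f_t,g_t,x_t)$, where $$\mathsf{dec}_\gamma(p;f,g,x)=\sup_{i^\star\in[K],\,v^\star\in[0,1]^K}\Big[\sum_{i}p_iv^\star_i-v^\star_{i^\star}-\frac\gamma4\sum_{i}p_i\sum_{j}g(x,i,j)(f(x,j)-v^\star_j)^2\Big].$$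 **Theorem.** There is a universal constant $C>0$ such that, in every setting as above, SquareCB.UG with $$\gamma=\max\Big\{4,\sqrt{\alpha(\mathcal G)\,T\log(KT)/R}\Big\}$$ has a well-defined expected regret, which satisfies $$\mathbb E\Big[\sum_{t=1}^T\big(f^\star(x_t,i_t)-\min_{i\in[K]}f^\star(x_t,i)\big)\Big]\le C\,\Big(1+\log\big(KT\max\{1,1/R\}\big)\Big)\sqrt{\alpha(\mathcal G)\,T\,R}.$$ In particular, the expected regret is $\tilde O\big(\sqrt{\alpha(\mathcal G)\,T\max\{\mathrm{Reg}_{\mathsf{Sq}},\mathrm{Reg}_{\mathsf{Log}}\}}\big)$, where $\tilde O$ hides a factor logarithmic in $K$ and $T$, whenever $R\ge 1$ (or, more generally, $1/R$ is at most polynomial in $KT$). -/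

import Mathlib

open MeasureTheory

/-! ### Feedback graphs and independence numbers -/

/-- A directed graph on `K` nodes (self-loops allowed), given by its set of edges. -/
abbrev FeedbackGraph (K : ℕ) : Type := Finset (Fin K × Fin K)

namespace FeedbackGraph

variable {K : ℕ}

/-- The entry `(i, j)` of the adjacency matrix: `1` if `(i, j)` is an edge and `0` otherwise. -/
def adj (G : FeedbackGraph K) (i j : Fin K) : ℝ := if (i, j) ∈ G then 1 else 0

/-- The set of nodes whose losses are observed when node `i` is played. -/
def observed (G : FeedbackGraph K) (i : Fin K) : Finset (Fin K) :=
  Finset.univ.filter fun j => (i, j) ∈ G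

/-- Every node either has a self-loop or is observed by every other node. -/
def StronglyObservable (G : FeedbackGraph K) : Prop :=
  ∀ i, (i, i) ∈ G ∨ ∀ j, j ≠ i → (j, i) ∈ G

/-- No two distinct nodes of `S` are connected by an edge, in either direction. -/
def IsIndependent (G : FeedbackGraph K) (S : Finset (Fin K)) : Prop :=
  ∀ i ∈ S, ∀ j ∈ S, i ≠ j → (i, j) ∉ G

instance (G : FeedbackGraph K) (S : Finset (Fin K)) : Decidable (G.IsIndependent S) :=
  inferInstanceAs (Decidable (∀ i ∈ S, ∀ j ∈ S, i ≠ j → (i, j) ∉ G))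

/-- The size of a largest independent set. -/
def indepNum (G : FeedbackGraph K) : ℕ :=
  ((Finset.univ : Finset (Finset (Fin K))).filter fun S => G.IsIndependent S).sup Finset.card

end FeedbackGraph

/-- Probability distributions `q` on strongly observable graphs whose mean adjacency matrix
is `M`. -/
def graphDistributions {K : ℕ} (M : Fin K → Fin K → ℝ) : Set (FeedbackGraph K → ℝ) :=
  {q | q ∈ stdSimplex ℝ (FeedbackGraph K) ∧
    (∀ G, q G ≠ 0 → G.StronglyObservable) ∧
    ∀ i j, ∑ G, q G * G.adj i j = M i j}

/-- `α(g, x)`: the smallest expected independence number of a distribution on strongly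
observable graphs with mean adjacency matrix `g x`. -/
noncomputable def alphaMean {𝒳 : Type*} {K : ℕ} (g : 𝒳 → Fin K → Fin K → ℝ) (x : 𝒳) : ℝ :=
  sInf ((fun q : FeedbackGraph K → ℝ => ∑ G, q G * (G.indepNum : ℝ)) '' graphDistributions (g x))

/-- `α(𝒢)`: the supremum of `α(g, x)` over all `g ∈ 𝒢` and all contexts `x`. -/
noncomputable def alphaClass {𝒳 : Type*} {K : ℕ} (𝒢 : Set (𝒳 → Fin K → Fin K → ℝ)) : ℝ :=
  ⨆ s : 𝒢 × 𝒳, alphaMean s.1.1 s.2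

/-! ### Log loss -/

/-- `log (1 / u)` for `u ∈ [0, 1]`, with value `∞` at `u = 0`. -/
noncomputable def logInv (u : ℝ) : ENNReal :=
  if u ≤ 0 then ⊤ else ENNReal.ofReal (Real.log (1 / u))

/-- `v log (1 / u) + (1 - v) log (1 / (1 - u))` for `u, v ∈ [0, 1]`, with values in `[0, ∞]` and
with `0 * ∞ = 0`. -/
noncomputable def logLoss (u v : ℝ) : ENNReal :=
  ENNReal.ofReal v * logInv u + ENNReal.ofReal (1 - v) * logInv (1 - u)

/-! ### The objective minimised by the algorithm -/

/-- The decision-estimation coefficient of the strategy `p`, where the supremum is over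
`i⋆ ∈ [K]` and `v⋆ ∈ [0, 1] ^ K`. -/
noncomputable def dec {𝒳 : Type*} {K : ℕ} (γ : ℝ) (p : Fin K → ℝ) (f : 𝒳 → Fin K → ℝ)
    (g : 𝒳 → Fin K → Fin K → ℝ) (x : 𝒳) : ℝ :=
  ⨆ s : Fin K × Set.Icc (0 : Fin K → ℝ) 1,
    (∑ i, p i * s.2.1 i - s.2.1 s.1
      - γ / 4 * ∑ i, p i * ∑ j, g x i j * (f x j - s.2.1 j) ^ 2)

/-! ### The interaction -/

/-- All random quantities of a `T`-round interaction with `K` actions, on a sample space `Ω`.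
The σ-algebra `info t` holds everything that is determined when the learner is about to draw
the action of round `t`, before the loss vector and the graph of that round are drawn. -/
structure Interaction (Ω : Type*) [MeasurableSpace Ω] (𝒳 : Type*) (K T : ℕ) where
  info : Filtration (Fin T) ‹MeasurableSpace Ω›
  context : Fin T → Ω → 𝒳
  loss : Fin T → Ω → Fin K → ℝ
  graph : Fin T → Ω → FeedbackGraph K
  action : Fin T → Ω → Fin K
  /-- the learner's distribution over actions, denoted `p_t` -/
  strategy : Fin T → Ω → Fin K → ℝ
  /-- the output `f_t` of the squared-loss regression oracle -/
  lossEst : Fin T → Ω → 𝒳 → Fin K → ℝ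
  /-- the output `g_t` of the log-loss regression oracle -/
  graphEst : Fin T → Ω → 𝒳 → Fin K → Fin K → ℝ

namespace Interaction

variable {Ω : Type*} [MeasurableSpace Ω] {𝒳 : Type*} {K T : ℕ}

/-- The σ-algebra generated by `info t` together with the loss vector and the graph of
round `t`. -/
abbrev infoWithEnv (I : Interaction Ω 𝒳 K T) (t : Fin T) : MeasurableSpace Ω :=
  I.info t ⊔ MeasurableSpace.comap (I.loss t) inferInstance
    ⊔ MeasurableSpace.comap (I.graph t) ⊤

/-- The protocol: contexts, losses and strongly observable graphs are selected by a possibly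
randomised and adaptive environment, and the action is drawn from the strategy, independently
of the loss vector and of the graph of the same round given `info t`. -/
structure FollowsProtocol [MeasurableSpace 𝒳] (I : Interaction Ω 𝒳 K T) (μ : Measure Ω) :
    Prop where
  context_meas : ∀ t, Measurable[I.info t] (I.context t)
  loss_meas : ∀ t, Measurable (I.loss t)
  graph_meas : ∀ t, Measurable[_, ⊤] (I.graph t)
  action_meas : ∀ t, Measurable (I.action t)
  past_loss : ∀ s t, s < t → Measurable[I.info t] (I.loss s)
  past_graph : ∀ s t, s < t → Measurable[I.info t, ⊤] (I.graph s)
  past_action : ∀ s t, s < t → Measurable[I.info t] (I.action s)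
  loss_mem : ∀ t, ∀ᵐ ω ∂μ, ∀ i, I.loss t ω i ∈ Set.Icc (0 : ℝ) 1
  graph_obs : ∀ t, ∀ᵐ ω ∂μ, (I.graph t ω).StronglyObservable
  strategy_meas : ∀ t, Measurable[I.info t] (I.strategy t)
  strategy_mem : ∀ t, ∀ᵐ ω ∂μ, I.strategy t ω ∈ stdSimplex ℝ (Fin K)
  action_law : ∀ t i, μ[fun ω => if I.action t ω = i then (1 : ℝ) else 0 | I.infoWithEnv t]
    =ᵐ[μ] fun ω => I.strategy t ω i

/-- `f⋆` is the mean loss function: given `info t`, the loss of action `i` has mean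
`f⋆(x_t, i)`. -/
def MeanLoss (I : Interaction Ω 𝒳 K T) (μ : Measure Ω) (fstar : 𝒳 → Fin K → ℝ) : Prop :=
  ∀ t i, μ[fun ω => I.loss t ω i | I.info t] =ᵐ[μ] fun ω => fstar (I.context t ω) i

/-- `g⋆` is the mean graph: given `info t`, the edge `(i, j)` is present with probability
`g⋆(x_t, i, j)`. -/
def MeanGraph (I : Interaction Ω 𝒳 K T) (μ : Measure Ω) (gstar : 𝒳 → Fin K → Fin K → ℝ) :
    Prop :=
  ∀ t i j, μ[fun ω => (I.graph t ω).adj i j | I.info t] =ᵐ[μ]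
    fun ω => gstar (I.context t ω) i j

/-- Given `info t`, the presence of an edge into `j` is uncorrelated with the loss of `j`. -/
def EdgesUncorrelatedWithLosses (I : Interaction Ω 𝒳 K T) (μ : Measure Ω) : Prop :=
  ∀ t i j, μ[fun ω => (I.graph t ω).adj i j * I.loss t ω j | I.info t] =ᵐ[μ]
    fun ω => (μ[fun ω => (I.graph t ω).adj i j | I.info t]) ω *
      (μ[fun ω => I.loss t ω j | I.info t]) ω

/-- The loss estimators come from an online regression oracle for `F`: each `f_t` lies in the
convex hull of `F`, is determined by the information available in round `t`, and the squared-loss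
regret on the data `(x_t, {(j, ℓ_{t, j}) : j ∈ A_t})` is at most `RegSq`. -/
structure SqOracle (I : Interaction Ω 𝒳 K T) (μ : Measure Ω) (F : Set (𝒳 → Fin K → ℝ))
    (RegSq : ℝ) : Prop where
  mem_conv : ∀ t, ∀ᵐ ω ∂μ, I.lossEst t ω ∈ convexHull ℝ F
  meas : ∀ t j, Measurable[I.info t] fun ω => I.lossEst t ω (I.context t ω) j
  regret : ∀ᵐ ω ∂μ,
    (∑ t, ∑ j ∈ (I.graph t ω).observed (I.action t ω),
        (I.lossEst t ω (I.context t ω) j - I.loss t ω j) ^ 2)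
      - (⨅ f : F, ∑ t, ∑ j ∈ (I.graph t ω).observed (I.action t ω),
        (f.1 (I.context t ω) j - I.loss t ω j) ^ 2) ≤ RegSq

/-- The graph estimators come from an online regression oracle for `𝒢`: each `g_t` lies in the
convex hull of `𝒢`, is determined by the information available in round `t`, and the log-loss
regret is at most `RegLog` on the data of partially revealed graphs, that is, on the triples
`(i_t, j, b)` for all `j`, where `b = 1` if `j ∈ A_t` and `b = 0` otherwise. -/
structure LogOraclePartial (I : Interaction Ω 𝒳 K T) (μ : Measure Ω)
    (𝒢 : Set (𝒳 → Fin K → Fin K → ℝ)) (RegLog : ℝ) : Prop where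
  mem_conv : ∀ t, ∀ᵐ ω ∂μ, I.graphEst t ω ∈ convexHull ℝ 𝒢
  meas : ∀ t i j, Measurable[I.info t] fun ω => I.graphEst t ω (I.context t ω) i j
  regret : ∀ᵐ ω ∂μ,
    (∑ t, ∑ j, logLoss (I.graphEst t ω (I.context t ω) (I.action t ω) j)
        ((I.graph t ω).adj (I.action t ω) j))
      ≤ (⨅ g ∈ 𝒢, ∑ t, ∑ j, logLoss (g (I.context t ω) (I.action t ω) j)
        ((I.graph t ω).adj (I.action t ω) j)) + ENNReal.ofReal RegLog

/-- The learner runs SquareCB.UG with parameter `γ`: in every round the strategy minimises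
`dec γ` at the current estimators and the current context over all distributions on the
actions. -/
def RunsSquareCBUG (I : Interaction Ω 𝒳 K T) (μ : Measure Ω) (γ : ℝ) : Prop :=
  ∀ t, ∀ᵐ ω ∂μ, I.strategy t ω ∈ stdSimplex ℝ (Fin K) ∧
    IsMinOn (fun p => dec γ p (I.lossEst t ω) (I.graphEst t ω) (I.context t ω))
      (stdSimplex ℝ (Fin K)) (I.strategy t ω)

/-- The realised regret against the best action of every round, as measured by `f⋆`. -/
noncomputable def pathRegret (I : Interaction Ω 𝒳 K T) (fstar : 𝒳 → Fin K → ℝ) (ω : Ω) : ℝ :=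
  ∑ t, (fstar (I.context t ω) (I.action t ω) - ⨅ i, fstar (I.context t ω) i)

end Interaction

/-! Write `p, f, g` for strategy and estimators in one round. Testing `dec` at `v⋆ = f⋆` bounds the
conditional regret by `dec γ p f g x` plus `γ/4` times the squared error of `f`, weighted by `p` and
`g`. The proof bounds these two terms separately and then balances `γ`.

The decision term (`dec_le_of_isMinOn`). By compactness and Sion's theorem it suffices to answer a
finitely supported prior on `(i⋆, v⋆)`. The answer is the law `a` of `i⋆`, mixed with a `1/γ` share
of uniform exploration. The remaining Bayes regret is a sum of covariances between `v⋆ j` and the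
event `i⋆ = j`. Cauchy–Schwarz and AM–GM pay for each of them with the information term, leaving `a
j (1 - a j) / (γ W j)`, where `W j` is the probability of observing `j`. As the information term is
linear in the mean graph, one strongly observable graph can be treated at a time. There, a loopless
node has `W j = 1 - p j`, which the variance factor cancels, and the nodes with loops obey a
directed Caro–Wei bound of order `α(G) log (Kγ)`. Averaging over a nearly optimal mixture of graphs
gives order `α(𝒢) log (Kγ) / γ`. Mixtures also show that passing to the convex hull of `𝒢` does not
increase this bound.

The estimation term. From `u ≤ 2 v + 2 (√u - √v) ^ 2`, the weight `g` may be exchanged for `g⋆` at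
the cost of a squared Hellinger distance. The error weighted by `g⋆` is the expected excess squared
loss on observed entries, because edges and losses are uncorrelated (`SqOracle.sum_integral_le`).
The Hellinger distance is controlled by the log-loss regret, through the expected square root of the
likelihood ratio (`LogOraclePartial.sum_integral_le`).

Altogether the regret is at most of order `T α(𝒢) log (Kγ) / γ + γ R`, and also at most `T`; the
prescribed `γ` balances the sum. -/

/-! ### Weighted sums over neighbourhoods -/

/-- The total weight of the members of `S` that are related to `i`. -/
def nbrWeight {α : Type*} (r : α → α → Prop) [DecidableRel r] (p : α → ℝ) (S : Finset α)
    (i : α) : ℝ :=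
  ∑ j ∈ S with r j i, p j

section NbrWeight

variable {α : Type*} (r : α → α → Prop) [DecidableRel r] (p : α → ℝ)

theorem le_nbrWeight (hr : ∀ i, r i i) {S : Finset α} (hp : ∀ i ∈ S, 0 < p i) {i : α}
    (hi : i ∈ S) : p i ≤ nbrWeight r p S i :=
  Finset.single_le_sum (f := p) (fun j hj => (hp j (Finset.mem_filter.1 hj).1).le)
    (Finset.mem_filter.2 ⟨hi, hr i⟩)

theorem nbrWeight_mono {S S' : Finset α} (h : S' ⊆ S) (hp : ∀ i ∈ S, 0 < p i) (i : α) :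
    nbrWeight r p S' i ≤ nbrWeight r p S i :=
  Finset.sum_le_sum_of_subset_of_nonneg (Finset.filter_subset_filter _ h)
    fun j hj _ => (hp j (Finset.mem_filter.1 hj).1).le

/-- The weighted Caro–Wei bound. -/
theorem exists_independent_sum_div_nbrWeight_le [DecidableEq α] (hr : ∀ i, r i i)
    (hs : ∀ i j, r i j → r j i) (S : Finset α) (hp : ∀ i ∈ S, 0 < p i) :
    ∃ I ⊆ S, (∀ i ∈ I, ∀ j ∈ I, i ≠ j → ¬ r i j) ∧
      ∑ i ∈ S, p i / nbrWeight r p S i ≤ I.card := by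
  induction S using Finset.strongInduction with
  | H S ih =>
    rcases S.eq_empty_or_nonempty with rfl | hne
    · exact ⟨∅, by simp, by simp, by simp⟩
    -- Greedy choice: with `i` of least neighbourhood weight, the neighbours of `i` contribute at
    -- most 1 in total. Deleting them only shrinks the other denominators, so the induction
    -- hypothesis covers the rest.
    obtain ⟨i, hi, hmin⟩ := Finset.exists_min_image S (nbrWeight r p S) hne
    have hssub : S.filter (fun j => ¬ r j i) ⊂ S :=
      Finset.filter_ssubset.2 ⟨i, hi, by simpa using hr i⟩
    obtain ⟨I, hIS, hI, hsum⟩ := ih _ hssub fun j hj => hp j (hssub.1 hj)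
    have hiI : i ∉ I := fun h => (Finset.mem_filter.1 (hIS h)).2 (hr i)
    have hW : 0 < nbrWeight r p S i := (hp i hi).trans_le (le_nbrWeight r p hr hp hi)
    refine ⟨insert i I, ?_, ?_, ?_⟩
    · exact Finset.insert_subset hi (hIS.trans hssub.1)
    · intro a ha b hb hab
      rcases Finset.mem_insert.1 ha with ha' | ha' <;>
        rcases Finset.mem_insert.1 hb with hb' | hb'
      · exact absurd (ha'.trans hb'.symm) hab
      · exact fun h => (Finset.mem_filter.1 (hIS hb')).2 (hs _ _ (ha' ▸ h))
      · exact hb' ▸ (Finset.mem_filter.1 (hIS ha')).2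
      · exact hI a ha' b hb' hab
    · rw [Finset.card_insert_of_notMem hiI, ← Finset.sum_filter_add_sum_filter_not S (r · i)]
      push_cast
      rw [add_comm]
      refine add_le_add (le_trans (Finset.sum_le_sum fun j hj => ?_) hsum) ?_
      · have hjS := (Finset.mem_filter.1 hj).1
        have hp' : ∀ k ∈ S.filter (fun j => ¬ r j i), 0 < p k := fun k hk => hp k (hssub.1 hk)
        exact div_le_div_of_nonneg_left (hp j hjS).le
          ((hp j hjS).trans_le (le_nbrWeight r p hr hp' hj)) (nbrWeight_mono r p hssub.1 hp j)
      · calc ∑ j ∈ S with r j i, p j / nbrWeight r p S j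
            ≤ ∑ j ∈ S with r j i, p j / nbrWeight r p S i := by
              refine Finset.sum_le_sum fun j hj => ?_
              have hjS := (Finset.mem_filter.1 hj).1
              exact div_le_div_of_nonneg_left (hp j hjS).le hW (hmin j hjS)
          _ = 1 := by rw [← Finset.sum_div]; exact div_self hW.ne'

/-- Some member of `S` has a large weight of in-neighbours. -/
theorem exists_le_nbrWeight [DecidableEq α] (hr : ∀ i, r i i) {S : Finset α}
    (hp : ∀ i ∈ S, 0 < p i) (hne : S.Nonempty) {a : ℝ}
    (ha : ∀ I ⊆ S, (∀ i ∈ I, ∀ j ∈ I, i ≠ j → ¬ r i j) → (I.card : ℝ) ≤ a) :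
    ∃ i ∈ S, ∑ j ∈ S, p j ≤ 2 * a * nbrWeight r p S i := by
  -- Symmetrising does not change the independent sets, since independence already forbids both
  -- directions.
  let r' : α → α → Prop := fun i j => r i j ∨ r j i
  have hr' : ∀ i, r' i i := fun i => Or.inl (hr i)
  obtain ⟨I, hIS, hI, hsum⟩ := exists_independent_sum_div_nbrWeight_le r' p hr'
    (fun i j h => h.symm) S hp
  have hP : 0 < ∑ j ∈ S, p j := Finset.sum_pos hp hne
  have hsum' := hsum.trans (ha I hIS fun i hi j hj hij h => hI i hi j hj hij (Or.inl h))
  have hpos : ∀ i ∈ S, 0 < nbrWeight r' p S i := fun i hi =>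
    (hp i hi).trans_le (le_nbrWeight r' p hr' hp hi)
  have hcs : (∑ j ∈ S, p j) ^ 2 ≤ (∑ i ∈ S, p i / nbrWeight r' p S i) *
      ∑ i ∈ S, p i * nbrWeight r' p S i := by
    refine Finset.sum_sq_le_sum_mul_sum_of_sq_le_mul S
      (fun i hi => (div_pos (hp i hi) (hpos i hi)).le)
      (fun i hi => (mul_pos (hp i hi) (hpos i hi)).le) fun i hi => le_of_eq ?_
    have := (hpos i hi).ne'
    field_simp
  -- In- and out-neighbourhoods have the same `p`-weighted total, which is where the factor 2 comes
  -- from.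
  have hsym : ∑ i ∈ S, p i * nbrWeight r' p S i ≤ 2 * ∑ i ∈ S, p i * nbrWeight r p S i := by
    have hswap : ∑ i ∈ S, p i * ∑ j ∈ S, (if r i j then p j else 0)
        = ∑ i ∈ S, p i * ∑ j ∈ S, (if r j i then p j else 0) := by
      simp_rw [Finset.mul_sum]
      rw [Finset.sum_comm]
      refine Finset.sum_congr rfl fun i _ => Finset.sum_congr rfl fun j _ => ?_
      split_ifs <;> ring
    simp only [nbrWeight, Finset.sum_filter]
    rw [two_mul]
    nth_rw 2 [← hswap]
    rw [← Finset.sum_add_distrib]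
    refine Finset.sum_le_sum fun i hi => ?_
    rw [← mul_add, ← Finset.sum_add_distrib]
    refine mul_le_mul_of_nonneg_left (Finset.sum_le_sum fun j hj => ?_) (hp i hi).le
    have := hp j hj
    by_cases h1 : r j i <;> by_cases h2 : r i j <;> simp [r', h1, h2, this.le]
  have ha0 : 0 ≤ a := le_trans (by positivity) (ha ∅ (by simp) (by simp))
  by_contra! hcon
  -- If every member failed, the `p`-weighted average would contradict the Cauchy–Schwarz bound
  -- `hcs`.
  have hlt : 2 * a * ∑ i ∈ S, p i * nbrWeight r p S i < (∑ j ∈ S, p j) ^ 2 := by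
    rw [sq, Finset.sum_mul, Finset.mul_sum]
    refine Finset.sum_lt_sum_of_nonempty hne fun i hi => ?_
    calc 2 * a * (p i * nbrWeight r p S i) = p i * (2 * a * nbrWeight r p S i) := by ring
      _ < _ := mul_lt_mul_of_pos_left (hcon i hi) (hp i hi)
  have hnn : 0 ≤ ∑ i ∈ S, p i * nbrWeight r' p S i :=
    Finset.sum_nonneg fun i hi => (mul_pos (hp i hi) (hpos i hi)).le
  nlinarith [mul_le_mul_of_nonneg_right hsum' hnn, mul_le_mul_of_nonneg_left hsym ha0]

/-- A directed analogue of the Caro–Wei bound, with a logarithmic loss. -/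
theorem sum_div_nbrWeight_le [DecidableEq α] (hr : ∀ i, r i i) {a c : ℝ} (hc : 0 < c)
    (S : Finset α) (hp : ∀ i ∈ S, c ≤ p i) (hne : S.Nonempty)
    (ha : ∀ I ⊆ S, (∀ i ∈ I, ∀ j ∈ I, i ≠ j → ¬ r i j) → (I.card : ℝ) ≤ a) :
    ∑ i ∈ S, p i / nbrWeight r p S i ≤ 2 * a * (1 + Real.log ((∑ i ∈ S, p i) / c)) := by
  induction S using Finset.strongInduction with
  | H S ih =>
    have hp0 : ∀ i ∈ S, 0 < p i := fun i hi => hc.trans_le (hp i hi)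
    have ha0 : 0 ≤ a := le_trans (by positivity) (ha ∅ (by simp) (by simp))
    -- Peel off a member with a heavy neighbourhood: its term is at most `2 a` times its share of
    -- the total weight. These shares telescope into a logarithm.
    obtain ⟨i, hi, hW⟩ := exists_le_nbrWeight r p hr hp0 hne ha
    have hP : 0 < ∑ j ∈ S, p j := Finset.sum_pos hp0 hne
    have hWpos : 0 < nbrWeight r p S i := (hp0 i hi).trans_le (le_nbrWeight r p hr hp0 hi)
    have hfirst : p i / nbrWeight r p S i ≤ 2 * a * (p i / ∑ j ∈ S, p j) := by
      rw [← mul_div_assoc, div_le_div_iff₀ hWpos hP]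
      nlinarith [mul_le_mul_of_nonneg_left hW (hp0 i hi).le]
    have hsub : S.erase i ⊆ S := Finset.erase_subset _ _
    rw [← Finset.add_sum_erase S _ hi]
    rcases (S.erase i).eq_empty_or_nonempty with he | he
    · have hS : ∑ j ∈ S, p j = p i := by rw [← Finset.add_sum_erase S _ hi, he]; simp
      rw [he, Finset.sum_empty, add_zero]
      refine hfirst.trans (mul_le_mul_of_nonneg_left ?_ (by positivity))
      rw [← Finset.add_sum_erase S _ hi, he, Finset.sum_empty, add_zero, div_self (hp0 i hi).ne']
      have : 0 ≤ Real.log (p i / c) := Real.log_nonneg ((one_le_div hc).2 (hp i hi))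
      linarith
    · have hrest := ih _ (Finset.erase_ssubset hi) (fun j hj => hp j (hsub hj)) he
        fun I hI => ha I (hI.trans hsub)
      have hP' : 0 < ∑ j ∈ S.erase i, p j := Finset.sum_pos (fun j hj => hp0 j (hsub hj)) he
      have hle : ∑ j ∈ S.erase i, p j / nbrWeight r p S j
          ≤ ∑ j ∈ S.erase i, p j / nbrWeight r p (S.erase i) j := by
        refine Finset.sum_le_sum fun j hj => ?_
        exact div_le_div_of_nonneg_left (hp0 j (hsub hj)).le
          ((hp0 j (hsub hj)).trans_le (le_nbrWeight r p hr (fun k hk => hp0 k (hsub hk)) hj))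
          (nbrWeight_mono r p hsub hp0 j)
      have hsplit : ∑ j ∈ S, p j = p i + ∑ j ∈ S.erase i, p j :=
        (Finset.add_sum_erase S _ hi).symm
      -- This is `1 - 1/z ≤ log z`, with `z` the ratio of the total weights before and after
      -- removing `i`.
      have hlog : p i / ∑ j ∈ S, p j
          ≤ Real.log (∑ j ∈ S, p j) - Real.log (∑ j ∈ S.erase i, p j) := by
        rw [← Real.log_div hP.ne' hP'.ne']
        have := Real.one_sub_inv_le_log_of_pos (div_pos hP hP')
        refine le_trans (le_of_eq ?_) this
        rw [inv_div, eq_sub_iff_add_eq, ← add_div, ← hsplit, div_self hP.ne']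
      rw [Real.log_div hP'.ne' hc.ne'] at hrest
      rw [Real.log_div hP.ne' hc.ne']
      have := mul_le_mul_of_nonneg_left hlog (by positivity : 0 ≤ 2 * a)
      linarith

end NbrWeight

/-! ### Observation probabilities in a strongly observable graph -/

namespace FeedbackGraph

variable {K : ℕ}

theorem adj_nonneg (G : FeedbackGraph K) (i j : Fin K) : 0 ≤ G.adj i j := by
  unfold adj; split_ifs <;> norm_num

theorem adj_le_one (G : FeedbackGraph K) (i j : Fin K) : G.adj i j ≤ 1 := by
  unfold adj; split_ifs <;> norm_num

theorem IsIndependent.card_le {G : FeedbackGraph K} {S : Finset (Fin K)} (h : G.IsIndependent S) :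
    S.card ≤ G.indepNum :=
  Finset.le_sup (f := Finset.card) (Finset.mem_filter.2 ⟨Finset.mem_univ _, h⟩)

theorem one_le_indepNum (G : FeedbackGraph K) (hK : 0 < K) : 1 ≤ G.indepNum := by
  have h : G.IsIndependent {⟨0, hK⟩} := by
    intro i hi j hj hij
    rw [Finset.mem_singleton] at hi hj
    exact absurd (hi.trans hj.symm) hij
  simpa using h.card_le

theorem indepNum_le (G : FeedbackGraph K) : G.indepNum ≤ K := by
  refine Finset.sup_le fun S _ => ?_
  simpa using Finset.card_le_univ S

/-- A loopless node is seen from every other node, so its denominator is exactly `1 - p j` and its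
term is `p j`; these terms sum to at most 1. On nodes with loops the factor `1 - p j` is dropped and
the directed Caro–Wei bound applies. -/
theorem sum_mul_adj_pos_and_sum_div_le {G : FeedbackGraph K} (hG : G.StronglyObservable)
    {p : Fin K → ℝ} (hp : p ∈ stdSimplex ℝ (Fin K)) {c : ℝ} (hc : 0 < c) (hcp : ∀ i, c ≤ p i)
    (hp1 : ∀ i, p i < 1) :
    (∀ j, 0 < ∑ i, p i * G.adj i j) ∧
      ∑ j, p j * (1 - p j) / ∑ i, p i * G.adj i j
        ≤ 1 + 2 * G.indepNum * (1 + Real.log (1 / c)) := by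
  have hp0 : ∀ i, 0 < p i := fun i => hc.trans_le (hcp i)
  set W : Fin K → ℝ := fun j => ∑ i, p i * G.adj i j with hW
  have hterm : ∀ i j, 0 ≤ p i * G.adj i j := fun i j => mul_nonneg (hp0 i).le (G.adj_nonneg i j)
  have hloop : ∀ j, (j, j) ∈ G → p j ≤ W j := fun j hj => by
    have := Finset.single_le_sum (f := fun i => p i * G.adj i j) (fun i _ => hterm i j)
      (Finset.mem_univ j)
    exact le_trans (le_of_eq (by simp [adj, hj])) this
  have hnoloop : ∀ j, (j, j) ∉ G → 1 - p j = W j := fun j hj => by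
    have hin : ∀ i, i ≠ j → (i, j) ∈ G := (hG j).resolve_left hj
    rw [← hp.2, hW, ← Finset.add_sum_erase _ _ (Finset.mem_univ j), add_sub_cancel_left]
    simp only
    rw [← Finset.add_sum_erase _ _ (Finset.mem_univ j)]
    simp only [adj, hj, if_false, mul_zero, zero_add]
    exact Finset.sum_congr rfl fun i hi => by simp [hin i (Finset.ne_of_mem_erase hi)]
  have hWpos : ∀ j, 0 < W j := fun j => by
    by_cases hj : (j, j) ∈ G
    · exact (hp0 j).trans_le (hloop j hj)
    · rw [← hnoloop j hj]; linarith [hp1 j]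
  refine ⟨hWpos, ?_⟩
  let S : Finset (Fin K) := Finset.univ.filter fun j => (j, j) ∈ G
  -- The reflexive closure of the edge relation; on `S` the loops are already edges, so
  -- neighbourhood weights are unaffected.
  let r : Fin K → Fin K → Prop := fun i j => i = j ∨ (i, j) ∈ G
  have hsumS : ∑ j ∈ S, p j ≤ 1 := by
    rw [← hp.2]
    exact Finset.sum_le_sum_of_subset_of_nonneg (Finset.subset_univ _) fun i _ _ => (hp0 i).le
  have hr : ∀ i, r i i := fun i => Or.inl rfl
  have h1 : ∑ j ∈ S, p j * (1 - p j) / W j ≤ 2 * G.indepNum * (1 + Real.log (1 / c)) := by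
    rcases S.eq_empty_or_nonempty with he | hne
    · rw [he, Finset.sum_empty]
      rcases isEmpty_or_nonempty (Fin K) with h | ⟨⟨i⟩⟩
      · exact absurd hp.2 (by simp)
      · have : 0 ≤ Real.log (1 / c) :=
          Real.log_nonneg ((one_le_div hc).2 ((hcp i).trans (hp1 i).le))
        positivity
    · have hmain := sum_div_nbrWeight_le r p hr (a := G.indepNum) hc S (fun i _ => hcp i) hne
        fun I _ hI => by
          have : G.IsIndependent I := fun i hi j hj hij h => hI i hi j hj hij (Or.inr h)
          exact_mod_cast this.card_le
      refine (Finset.sum_le_sum fun j hj => ?_).trans (hmain.trans ?_)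
      · have hjS : (j, j) ∈ G := (Finset.mem_filter.1 hj).2
        have hle : nbrWeight r p S j ≤ W j := by
          rw [nbrWeight, Finset.sum_filter]
          refine (Finset.sum_le_sum (g := fun i => p i * G.adj i j) fun i _ => ?_).trans
            (Finset.sum_le_sum_of_subset_of_nonneg (Finset.subset_univ S) fun i _ _ => hterm i j)
          by_cases hij : (i, j) ∈ G
          · simp [r, adj, hij]
          · have : i ≠ j := by rintro rfl; exact hij hjS
            simp [r, adj, hij, this]
        have hn : 0 < nbrWeight r p S j :=
          (hp0 j).trans_le (le_nbrWeight r p hr (fun i _ => hp0 i) hj)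
        refine (div_le_div_of_nonneg_left ?_ hn hle).trans ?_
        · exact mul_nonneg (hp0 j).le (by linarith [hp1 j])
        · refine div_le_div_of_nonneg_right ?_ hn.le
          nlinarith [hp0 j, hp1 j]
      · have hS : 0 < ∑ j ∈ S, p j := Finset.sum_pos (fun i _ => hp0 i) hne
        gcongr
  have h2 : ∑ j with ¬ (j, j) ∈ G, p j * (1 - p j) / W j ≤ 1 := by
    refine le_trans ?_ hp.2.le
    refine le_trans (Finset.sum_le_sum (g := p) fun j hj => le_of_eq ?_)
      (Finset.sum_le_sum_of_subset_of_nonneg (Finset.subset_univ _) fun i _ _ => (hp0 i).le)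
    have hj' : (j, j) ∉ G := (Finset.mem_filter.1 hj).2
    rw [hnoloop j hj', mul_div_assoc, div_self (hWpos j).ne', mul_one]
  rw [← Finset.sum_filter_add_sum_filter_not Finset.univ (fun j => (j, j) ∈ G), add_comm]
  exact add_le_add h2 h1

end FeedbackGraph

/-! ### The minimax bound -/

/-- A minimax principle for payoffs that are linear in a mixed strategy. -/
theorem exists_mem_stdSimplex_forall_sum_mul_le {ι S : Type*} [Fintype ι] [Nonempty ι]
    (A : S → ι → ℝ) (B : ℝ)
    (h : ∀ (u : Finset S) (w : u → ℝ), w ∈ stdSimplex ℝ u →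
      ∃ p ∈ stdSimplex ℝ ι, ∑ s, w s * ∑ i, p i * A s i ≤ B) :
    ∃ p ∈ stdSimplex ℝ ι, ∀ s, ∑ i, p i * A s i ≤ B := by
  classical
  have hne : (stdSimplex ℝ ι).Nonempty := ⟨_, single_mem_stdSimplex ℝ (Classical.arbitrary ι)⟩
  -- The constraint sets are closed in a compact simplex, so finitely many constraints at a time
  -- suffice. Only finitely supported priors are then needed.
  have key := IsCompact.inter_iInter_nonempty (isCompact_stdSimplex ℝ ι)
    (fun s : S => {p : ι → ℝ | ∑ i, p i * A s i ≤ B})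
    (fun s => isClosed_le (by fun_prop) continuous_const) fun u => ?_
  · obtain ⟨p, hp, hp'⟩ := key
    exact ⟨p, hp, fun s => Set.mem_iInter.1 hp' s⟩
  rcases u.eq_empty_or_nonempty with rfl | ⟨s₀, hs₀⟩
  · simpa using hne
  have : Nonempty u := ⟨⟨s₀, hs₀⟩⟩
  obtain ⟨a, ha, b, hb, hab⟩ := Sion.exists_isSaddlePointOn
    (X := stdSimplex ℝ ι) (Y := stdSimplex ℝ u)
    (f := fun p w => ∑ s, w s * ∑ i, p i * A s i) hne (convex_stdSimplex ℝ ι)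
    (isCompact_stdSimplex ℝ ι)
    (fun w _ => (Continuous.lowerSemicontinuous (by fun_prop)).lowerSemicontinuousOn _)
    (fun w _ => by
      refine ConvexOn.quasiconvexOn ⟨convex_stdSimplex ℝ ι, fun x _ y _ a b _ _ _ => le_of_eq ?_⟩
      simp only [Pi.add_apply, Pi.smul_apply, smul_eq_mul, add_mul, Finset.sum_add_distrib,
        mul_add, Finset.mul_sum]
      congr 1 <;> refine Finset.sum_congr rfl fun _ _ => Finset.sum_congr rfl fun _ _ => by ring)
    (convex_stdSimplex ℝ u) ⟨_, single_mem_stdSimplex ℝ (⟨s₀, hs₀⟩ : u)⟩ (isCompact_stdSimplex ℝ u)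
    (fun p _ => (Continuous.upperSemicontinuous (by fun_prop)).upperSemicontinuousOn _)
    (fun p _ => by
      refine ConcaveOn.quasiconcaveOn
        ⟨convex_stdSimplex ℝ u, fun x _ y _ a b _ _ _ => le_of_eq ?_⟩
      simp only [Pi.add_apply, Pi.smul_apply, smul_eq_mul, add_mul, Finset.sum_add_distrib,
        Finset.mul_sum]
      congr 1 <;> refine Finset.sum_congr rfl fun _ _ => Finset.sum_congr rfl fun _ _ => by ring)
  obtain ⟨p, hp, hpB⟩ := h u b hb
  refine ⟨a, ha, Set.mem_iInter₂.2 fun s hs => ?_⟩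
  -- A vertex of the dual simplex isolates the payoff of the single `s`.
  have := (hab p hp _ (single_mem_stdSimplex ℝ (⟨s, hs⟩ : u))).trans hpB
  simpa [Pi.single_apply, ite_mul] using this

/-- The expected independence number of a graph with distribution `q`. -/
noncomputable def meanIndepNum {K : ℕ} (q : FeedbackGraph K → ℝ) : ℝ :=
  ∑ G, q G * (G.indepNum : ℝ)

theorem one_le_meanIndepNum {K : ℕ} (hK : 0 < K) {q : FeedbackGraph K → ℝ}
    (hq : q ∈ stdSimplex ℝ (FeedbackGraph K)) : 1 ≤ meanIndepNum q := by
  rw [← hq.2]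
  refine Finset.sum_le_sum fun G _ => le_mul_of_one_le_right (hq.1 G) ?_
  exact_mod_cast G.one_le_indepNum hK

theorem meanIndepNum_le {K : ℕ} {q : FeedbackGraph K → ℝ}
    (hq : q ∈ stdSimplex ℝ (FeedbackGraph K)) : meanIndepNum q ≤ K := by
  calc meanIndepNum q ≤ ∑ G, q G * (K : ℝ) :=
        Finset.sum_le_sum fun G _ =>
          mul_le_mul_of_nonneg_left (by exact_mod_cast G.indepNum_le) (hq.1 G)
    _ = K := by rw [← Finset.sum_mul, hq.2, one_mul]

/-- AM–GM with a free parameter `b`, which is later chosen as `γ` times an observation probability.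
-/
theorem le_add_div_of_sq_le_mul {c V D b : ℝ} (hV : 0 ≤ V) (hD : 0 ≤ D) (hb : 0 < b)
    (h : c ^ 2 ≤ V * D) : c ≤ b / 4 * V + D / b := by
  refine (le_abs_self c).trans (abs_le_of_sq_le_sq ?_ (by positivity))
  have h1 : V * D = 4 * ((b / 4 * V) * (D / b)) := by field_simp
  nlinarith [sq_nonneg (b / 4 * V - D / b)]

/-! ### Bayesian second-moment inequalities -/

section Bayes

variable {S : Type*} [Fintype S] {w : S → ℝ}

/-- Bias–variance decomposition. It makes the decision bound independent of the estimator: the prior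
mean is the least favourable choice of `f`. -/
theorem sum_mul_sub_sq_ge (hw : w ∈ stdSimplex ℝ S) (v : S → ℝ) (a : ℝ) :
    ∑ s, w s * ((∑ s, w s * v s) - v s) ^ 2 ≤ ∑ s, w s * (a - v s) ^ 2 := by
  set m := ∑ s, w s * v s with hm
  have : ∑ s, w s * (a - v s) ^ 2 = ∑ s, w s * (m - v s) ^ 2 + (a - m) ^ 2 := by
    have e : ∀ s, w s * (a - v s) ^ 2
        = w s * (m - v s) ^ 2 + (w s * (a ^ 2 - m ^ 2) - 2 * (a - m) * (w s * v s)) := by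
      intro s; ring
    rw [Finset.sum_congr rfl fun s _ => e s, Finset.sum_add_distrib, Finset.sum_sub_distrib,
      ← Finset.sum_mul, ← Finset.mul_sum, hw.2, ← hm]
    ring
  rw [this]; nlinarith [sq_nonneg (a - m)]

/-- The Cauchy–Schwarz inequality for the covariance of `v` and an indicator. -/
theorem sq_sum_mul_indicator_le (hw : w ∈ stdSimplex ℝ S) (v : S → ℝ) (P : S → Prop)
    [DecidablePred P] :
    (∑ s, w s * (((∑ s, w s * v s) - v s) * if P s then 1 else 0)) ^ 2 ≤
      (∑ s, w s * ((∑ s, w s * v s) - v s) ^ 2) *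
        ((∑ s, w s * if P s then 1 else 0) * (1 - ∑ s, w s * if P s then 1 else 0)) := by
  set m := ∑ s, w s * v s with hm
  set a := ∑ s, w s * (if P s then (1 : ℝ) else 0) with ha
  -- Since `m - v` has mean zero, the indicator may be centred; its variance is `a (1 - a)`.
  have h1 : ∑ s, w s * ((m - v s) * if P s then 1 else 0)
      = ∑ s, w s * ((m - v s) * ((if P s then 1 else 0) - a)) := by
    have e : ∀ s, w s * ((m - v s) * ((if P s then 1 else 0) - a))
        = w s * ((m - v s) * if P s then 1 else 0) - (w s * (m * a) - a * (w s * v s)) := by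
      intro s; ring
    rw [Finset.sum_congr rfl fun s _ => e s, Finset.sum_sub_distrib, Finset.sum_sub_distrib,
      ← Finset.sum_mul, ← Finset.mul_sum, hw.2, ← hm]
    ring
  have h2 : a * (1 - a) = ∑ s, w s * ((if P s then 1 else 0) - a) ^ 2 := by
    have e : ∀ s, w s * ((if P s then 1 else 0) - a) ^ 2
        = (1 - 2 * a) * (w s * if P s then 1 else 0) + w s * a ^ 2 := by
      intro s; split_ifs <;> ring
    rw [Finset.sum_congr rfl fun s _ => e s, Finset.sum_add_distrib,
      ← Finset.sum_mul, ← Finset.mul_sum, hw.2, ← ha]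
    ring
  rw [h1, h2]
  refine Finset.sum_sq_le_sum_mul_sum_of_sq_le_mul _ (fun s _ => ?_) (fun s _ => ?_)
    fun s _ => le_of_eq (by ring)
  · exact mul_nonneg (hw.1 s) (sq_nonneg _)
  · exact mul_nonneg (hw.1 s) (sq_nonneg _)

end Bayes

/-- For a known distribution `w` of the environment, a smoothed version of the law of the optimal
action is a good strategy. -/
theorem exists_strategy_of_prior {K : ℕ} (hK : 2 ≤ K) {M : Fin K → Fin K → ℝ}
    {q : FeedbackGraph K → ℝ} (hq : q ∈ graphDistributions M) (f : Fin K → ℝ) {γ : ℝ}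
    (hγ : 4 ≤ γ) {S : Type*} [Fintype S] (opt : S → Fin K) (v : S → Fin K → ℝ)
    (hv : ∀ s i, v s i ∈ Set.Icc (0 : ℝ) 1) {w : S → ℝ} (hw : w ∈ stdSimplex ℝ S) :
    ∃ p ∈ stdSimplex ℝ (Fin K),
      ∑ s, w s * ∑ i, p i * (v s i - v s (opt s) - γ / 4 * ∑ j, M i j * (f j - v s j) ^ 2)
        ≤ (3 + 4 * meanIndepNum q * (1 + Real.log (K * γ))) / γ := by
  obtain ⟨hqs, hqo, hqM⟩ := hq
  have hγ0 : 0 < γ := by linarith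
  have hK0 : (0 : ℝ) < K := by exact_mod_cast (by omega : 0 < K)
  have hK2 : (2 : ℝ) ≤ K := by exact_mod_cast hK
  -- Exploration at rate `1/γ` costs `1/γ` in regret, and the resulting floor `ε / K` on `p` becomes
  -- `log (Kγ)` in the graph bound.
  set ε := 1 / γ with hε
  have hε0 : 0 < ε := by positivity
  have hε4 : ε ≤ 1 / 4 := one_div_le_one_div_of_le (by norm_num) hγ
  set a : Fin K → ℝ := fun j => ∑ s, w s * (if opt s = j then 1 else 0) with ha
  have ha0 : ∀ j, 0 ≤ a j := fun j =>
    Finset.sum_nonneg fun s _ => mul_nonneg (hw.1 s) (by split_ifs <;> norm_num)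
  have ha_sum : ∑ j, a j = 1 := by
    rw [← hw.2, ha, Finset.sum_comm]
    refine Finset.sum_congr rfl fun s _ => ?_
    rw [← Finset.mul_sum]; simp
  have ha1 : ∀ j, a j ≤ 1 := fun j => by
    rw [← ha_sum]; exact Finset.single_le_sum (fun i _ => ha0 i) (Finset.mem_univ j)
  set p : Fin K → ℝ := fun j => (1 - ε) * a j + ε / K with hp
  have hcp : ∀ j, ε / K ≤ p j := fun j => by
    have : 0 ≤ (1 - ε) * a j := mul_nonneg (by linarith) (ha0 j)
    simp only [hp]; linarith
  -- With at least two actions, exploration keeps every `p j` strictly below 1 even when `a j = 1`.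
  have hεK : ε / K ≤ ε / 2 := div_le_div_of_nonneg_left hε0.le (by norm_num) hK2
  have hεK0 : 0 < ε / K := by positivity
  have hp1 : ∀ j, p j < 1 := fun j => by
    have : (1 - ε) * a j ≤ (1 - ε) * 1 := mul_le_mul_of_nonneg_left (ha1 j) (by linarith)
    simp only [hp]; linarith
  have hps : p ∈ stdSimplex ℝ (Fin K) := by
    refine ⟨fun j => hεK0.le.trans (hcp j), ?_⟩
    simp only [hp, Finset.sum_add_distrib, ← Finset.mul_sum, ha_sum, Finset.sum_const,
      Finset.card_univ, Fintype.card_fin, nsmul_eq_mul]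
    field_simp; ring
  refine ⟨p, hps, ?_⟩
  set m : Fin K → ℝ := fun j => ∑ s, w s * v s j with hm
  have hm0 : ∀ j, 0 ≤ m j := fun j =>
    Finset.sum_nonneg fun s _ => mul_nonneg (hw.1 s) (hv s j).1
  have hm1 : ∀ j, m j ≤ 1 := fun j => by
    rw [← hw.2]
    exact Finset.sum_le_sum fun s _ => mul_le_of_le_one_right (hw.1 s) (hv s j).2
  set c : Fin K → ℝ := fun j => ∑ s, w s * ((m j - v s j) * if opt s = j then 1 else 0) with hc
  set V : Fin K → ℝ := fun j => ∑ s, w s * (m j - v s j) ^ 2 with hV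
  have hV0 : ∀ j, 0 ≤ V j := fun j =>
    Finset.sum_nonneg fun s _ => mul_nonneg (hw.1 s) (sq_nonneg _)
  have hcV : ∀ j, c j ^ 2 ≤ V j * (a j * (1 - a j)) := fun j =>
    sq_sum_mul_indicator_le hw (fun s => v s j) (fun s => opt s = j)
  have hM0 : ∀ i j, 0 ≤ M i j := fun i j => by
    rw [← hqM]; exact Finset.sum_nonneg fun G _ => mul_nonneg (hqs.1 G) (G.adj_nonneg i j)
  -- the payoff splits into a regret part and an information part
  have hsplit : ∑ s, w s * ∑ i, p i *
        (v s i - v s (opt s) - γ / 4 * ∑ j, M i j * (f j - v s j) ^ 2)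
      = (∑ j, (p j - a j) * m j + ∑ j, c j)
        - γ / 4 * ∑ j, (∑ i, p i * M i j) * ∑ s, w s * (f j - v s j) ^ 2 := by
    have e1 : ∀ s, ∑ i, p i * (v s i - v s (opt s) - γ / 4 * ∑ j, M i j * (f j - v s j) ^ 2)
        = (∑ i, p i * v s i) - v s (opt s)
          - γ / 4 * ∑ i, p i * ∑ j, M i j * (f j - v s j) ^ 2 := by
      intro s
      simp only [mul_sub, Finset.sum_sub_distrib, ← Finset.sum_mul, hps.2, one_mul]
      congr 1
      rw [Finset.mul_sum]
      exact Finset.sum_congr rfl fun i _ => by ring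
    have e2 : ∑ s, w s * ∑ i, p i * v s i = ∑ j, p j * m j := by
      simp only [hm, Finset.mul_sum]
      rw [Finset.sum_comm]
      exact Finset.sum_congr rfl fun i _ => Finset.sum_congr rfl fun s _ => by ring
    have e3 : ∑ s, w s * v s (opt s) = ∑ j, a j * m j - ∑ j, c j := by
      rw [← Finset.sum_sub_distrib]
      have : ∀ j, a j * m j - c j = ∑ s, w s * (v s j * if opt s = j then 1 else 0) := by
        intro j
        simp only [ha, hc]
        rw [Finset.sum_mul, ← Finset.sum_sub_distrib]
        exact Finset.sum_congr rfl fun s _ => by ring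
      rw [Finset.sum_congr rfl fun j _ => this j, Finset.sum_comm]
      refine Finset.sum_congr rfl fun s _ => ?_
      rw [← Finset.mul_sum]; simp
    have e4 : ∑ s, w s * (γ / 4 * ∑ i, p i * ∑ j, M i j * (f j - v s j) ^ 2)
        = γ / 4 * ∑ j, (∑ i, p i * M i j) * ∑ s, w s * (f j - v s j) ^ 2 := by
      have : ∀ s, w s * (γ / 4 * ∑ i, p i * ∑ j, M i j * (f j - v s j) ^ 2)
          = γ / 4 * ∑ j, (∑ i, p i * M i j) * (w s * (f j - v s j) ^ 2) := by
        intro s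
        rw [mul_left_comm]
        congr 1
        simp only [Finset.mul_sum, Finset.sum_mul]
        rw [Finset.sum_comm]
        exact Finset.sum_congr rfl fun i _ => Finset.sum_congr rfl fun s _ => by ring
      rw [Finset.sum_congr rfl fun s _ => this s, ← Finset.mul_sum, Finset.sum_comm]
      simp only [Finset.mul_sum]
    simp only [e1]
    simp only [mul_sub, Finset.sum_sub_distrib]
    rw [e2, e3, e4]
    simp only [sub_mul, Finset.sum_sub_distrib]
    ring
  have hmix : ∑ j, (p j - a j) * m j ≤ ε := by
    have : ∀ j, (p j - a j) * m j ≤ ε / K := fun j => by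
      have e : p j - a j = ε / K - ε * a j := by simp only [hp]; ring
      rw [e, sub_mul]
      have h1 : 0 ≤ ε * a j * m j := mul_nonneg (mul_nonneg hε0.le (ha0 j)) (hm0 j)
      have h2 : ε / K * m j ≤ ε / K := mul_le_of_le_one_right hεK0.le (hm1 j)
      linarith
    refine (Finset.sum_le_sum fun j _ => this j).trans (le_of_eq ?_)
    simp; field_simp
  have hinfo : ∑ j, (∑ i, p i * M i j) * V j
      ≤ ∑ j, (∑ i, p i * M i j) * ∑ s, w s * (f j - v s j) ^ 2 :=
    Finset.sum_le_sum fun j _ => mul_le_mul_of_nonneg_left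
      (sum_mul_sub_sq_ge hw (fun s => v s j) (f j))
      (Finset.sum_nonneg fun i _ => mul_nonneg (hps.1 i) (hM0 i j))
  -- The expression is affine in the mean graph, hence the `q`-average of its values at individual
  -- graphs.
  have hav : ∀ j, c j - γ / 4 * ((∑ i, p i * M i j) * V j)
      = ∑ G, q G * (c j - γ / 4 * ((∑ i, p i * G.adj i j) * V j)) := by
    intro j
    have e : ∑ i, p i * M i j = ∑ G, q G * ∑ i, p i * G.adj i j := by
      simp only [← hqM, Finset.mul_sum]
      rw [Finset.sum_comm]
      exact Finset.sum_congr rfl fun i _ => Finset.sum_congr rfl fun s _ => by ring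
    rw [e]
    simp only [mul_sub, Finset.sum_sub_distrib, ← Finset.sum_mul, hqs.2, one_mul]
    congr 1
    rw [Finset.sum_mul, Finset.mul_sum]
    exact Finset.sum_congr rfl fun i _ => by ring
  have hgraph : ∀ G, q G * ∑ j, (c j - γ / 4 * ((∑ i, p i * G.adj i j) * V j))
      ≤ q G * (2 / γ * (1 + 2 * G.indepNum * (1 + Real.log (K * γ)))) := by
    intro G
    rcases eq_or_ne (q G) 0 with h0 | h0
    · simp [h0]
    refine mul_le_mul_of_nonneg_left ?_ (hqs.1 G)
    obtain ⟨hW, hsum⟩ := FeedbackGraph.sum_mul_adj_pos_and_sum_div_le (hqo G h0) hps hεK0 hcp hp1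
    have hKγ : 1 / (ε / K) = K * γ := by rw [hε]; field_simp
    rw [hKγ] at hsum
    refine le_trans ?_ (mul_le_mul_of_nonneg_left hsum (by positivity))
    rw [Finset.mul_sum]
    refine Finset.sum_le_sum fun j _ => ?_
    have h1 := le_add_div_of_sq_le_mul (hV0 j) (mul_nonneg (ha0 j) (by linarith [ha1 j]))
      (mul_pos hγ0 (hW j)) (hcV j)
    -- Smoothing loses a factor at most `4/3` in each of `a j` and `1 - a j`, because `ε ≤ 1/4`; and
    -- `16/9 ≤ 2`.
    have h2 : a j * (1 - a j) ≤ 2 * (p j * (1 - p j)) := by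
      have b1 : 3 / 4 * a j ≤ p j := by
        simp only [hp]; nlinarith [ha0 j]
      have b2 : 3 / 4 * (1 - a j) ≤ 1 - p j := by
        simp only [hp]; nlinarith [ha1 j]
      have b3 := mul_le_mul b1 b2 (by linarith [ha1 j]) (hps.1 j)
      nlinarith [mul_nonneg (ha0 j) (by linarith [ha1 j] : 0 ≤ 1 - a j)]
    have h3 : a j * (1 - a j) / (γ * ∑ i, p i * G.adj i j)
        ≤ 2 / γ * (p j * (1 - p j) / ∑ i, p i * G.adj i j) := by
      rw [div_mul_div_comm]
      exact div_le_div_of_nonneg_right h2 (mul_pos hγ0 (hW j)).le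
    linarith
  have hfin : ∑ j, c j - γ / 4 * ∑ j, (∑ i, p i * M i j) * V j
      ≤ 2 / γ * (1 + 2 * meanIndepNum q * (1 + Real.log (K * γ))) := by
    rw [Finset.mul_sum, ← Finset.sum_sub_distrib, Finset.sum_congr rfl fun j _ => hav j,
      Finset.sum_comm]
    simp only [← Finset.mul_sum]
    refine (Finset.sum_le_sum fun G _ => hgraph G).trans (le_of_eq ?_)
    have e : ∀ G : FeedbackGraph K,
        q G * (2 / γ * (1 + 2 * G.indepNum * (1 + Real.log (K * γ))))
        = q G * (2 / γ) + q G * G.indepNum * (4 / γ * (1 + Real.log (K * γ))) := by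
      intro G; ring
    rw [Finset.sum_congr rfl fun G _ => e G, Finset.sum_add_distrib, ← Finset.sum_mul,
      ← Finset.sum_mul, hqs.2, meanIndepNum]
    ring
  rw [hsplit]
  have hγ4 : 0 ≤ γ / 4 := by positivity
  have := mul_le_mul_of_nonneg_left hinfo hγ4
  have e : (3 + 4 * meanIndepNum q * (1 + Real.log (K * γ))) / γ
      = ε + 2 / γ * (1 + 2 * meanIndepNum q * (1 + Real.log (K * γ))) := by
    rw [hε]; field_simp; ring
  rw [e]
  linarith

/-! ### Independence numbers of a class and of its convex hull -/

section AlphaClass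

variable {𝒳 : Type*} {K : ℕ}

theorem alphaMean_bounds (hK : 0 < K) {g : 𝒳 → Fin K → Fin K → ℝ} {x : 𝒳}
    (h : (graphDistributions (g x)).Nonempty) : alphaMean g x ∈ Set.Icc (1 : ℝ) K := by
  obtain ⟨q, hq⟩ := h
  have hlow : 1 ∈ lowerBounds (meanIndepNum '' graphDistributions (g x)) := by
    rintro _ ⟨q', hq', rfl⟩
    exact one_le_meanIndepNum hK hq'.1
  exact ⟨le_csInf (Set.image_nonempty.2 ⟨q, hq⟩) hlow,
    (csInf_le ⟨1, hlow⟩ (Set.mem_image_of_mem meanIndepNum hq)).trans (meanIndepNum_le hq.1)⟩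

variable {𝒢 : Set (𝒳 → Fin K → Fin K → ℝ)}

/-- The uniform bound `K` makes the real supremum genuine rather than the default value 0. -/
theorem alphaMean_le_alphaClass (hK : 0 < K)
    (h𝒢 : ∀ g ∈ 𝒢, ∀ x, (graphDistributions (g x)).Nonempty) {g : 𝒳 → Fin K → Fin K → ℝ}
    (hg : g ∈ 𝒢) (x : 𝒳) : alphaMean g x ≤ alphaClass 𝒢 := by
  refine le_ciSup (f := fun s : 𝒢 × 𝒳 => alphaMean s.1.1 s.2) ⟨K, ?_⟩ (⟨g, hg⟩, x)
  rintro _ ⟨s, rfl⟩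
  exact (alphaMean_bounds hK (h𝒢 _ s.1.2 s.2)).2

theorem alphaClass_bounds (hK : 0 < K) (h𝒢 : ∀ g ∈ 𝒢, ∀ x, (graphDistributions (g x)).Nonempty)
    {g : 𝒳 → Fin K → Fin K → ℝ} (hg : g ∈ 𝒢) (x : 𝒳) : alphaClass 𝒢 ∈ Set.Icc (1 : ℝ) K := by
  refine ⟨(alphaMean_bounds hK (h𝒢 g hg x)).1.trans (alphaMean_le_alphaClass hK h𝒢 hg x), ?_⟩
  have : Nonempty (𝒢 × 𝒳) := ⟨(⟨g, hg⟩, x)⟩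
  exact ciSup_le fun s => (alphaMean_bounds hK (h𝒢 _ s.1.2 s.2)).2

/-- Mixing two graph distributions mixes their mean graphs and their expected independence numbers,
and stays supported on strongly observable graphs. -/
theorem convex_setOf_exists_graphDistribution (x : 𝒳) (c : ℝ) :
    Convex ℝ {g : 𝒳 → Fin K → Fin K → ℝ |
      ∃ q ∈ graphDistributions (g x), meanIndepNum q ≤ c} := by
  rintro g ⟨q, ⟨hqs, hqo, hqM⟩, hqc⟩ g' ⟨q', ⟨hqs', hqo', hqM'⟩, hqc'⟩ a b ha hb hab
  refine ⟨a • q + b • q', ⟨convex_stdSimplex ℝ _ hqs hqs' ha hb hab, fun G hG => ?_,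
    fun i j => ?_⟩, ?_⟩
  · by_cases h : q G = 0
    · refine hqo' G fun h' => hG ?_
      simp [h, h']
    · exact hqo G h
  · simp only [Pi.add_apply, Pi.smul_apply, smul_eq_mul, ← hqM, ← hqM', add_mul, mul_assoc,
      Finset.sum_add_distrib, Finset.mul_sum]
  · have e : meanIndepNum (a • q + b • q') = a * meanIndepNum q + b * meanIndepNum q' := by
      simp only [meanIndepNum, Pi.add_apply, Pi.smul_apply, smul_eq_mul, add_mul, mul_assoc,
        Finset.sum_add_distrib, Finset.mul_sum]
    calc _ = a * meanIndepNum q + b * meanIndepNum q' := e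
      _ ≤ a * c + b * c := by gcongr
      _ = c := by rw [← add_mul, hab, one_mul]

theorem exists_graphDistribution_of_mem_convexHull (hK : 0 < K)
    (h𝒢 : ∀ g ∈ 𝒢, ∀ x, (graphDistributions (g x)).Nonempty) {g : 𝒳 → Fin K → Fin K → ℝ}
    (hg : g ∈ convexHull ℝ 𝒢) (x : 𝒳) :
    ∃ q ∈ graphDistributions (g x), meanIndepNum q ≤ 2 * alphaClass 𝒢 := by
  refine convexHull_min (fun g hg => ?_)
    (convex_setOf_exists_graphDistribution x (2 * alphaClass 𝒢)) hg
  have hle := alphaMean_le_alphaClass hK h𝒢 hg x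
  have h1 := (alphaClass_bounds hK h𝒢 hg x).1
  -- The factor 2 leaves room for a near-minimiser, so that attainment of the infimum is not needed;
  -- it is strict because `1 ≤ alphaClass 𝒢`.
  obtain ⟨_, ⟨q, hq, rfl⟩, hlt⟩ := exists_lt_of_csInf_lt
    (Set.image_nonempty.2 (h𝒢 g hg x)) (show alphaMean g x < 2 * alphaClass 𝒢 by linarith)
  exact ⟨q, hq, hlt.le⟩

end AlphaClass

/-! ### Bounds on the decision-estimation coefficient -/

section Dec

variable {𝒳 : Type*} {K : ℕ} {γ : ℝ} {f : 𝒳 → Fin K → ℝ} {g : 𝒳 → Fin K → Fin K → ℝ} {x : 𝒳}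

/-- Without boundedness the real supremum in `dec` would default to 0 and could not be bounded below
by its terms. -/
theorem bddAbove_dec (hγ : 0 ≤ γ) (hg : ∀ i j, 0 ≤ g x i j) {p : Fin K → ℝ}
    (hp : p ∈ stdSimplex ℝ (Fin K)) :
    BddAbove (Set.range fun s : Fin K × Set.Icc (0 : Fin K → ℝ) 1 =>
      ∑ i, p i * s.2.1 i - s.2.1 s.1
        - γ / 4 * ∑ i, p i * ∑ j, g x i j * (f x j - s.2.1 j) ^ 2) := by
  refine ⟨1, ?_⟩
  rintro _ ⟨⟨i, v, hv⟩, rfl⟩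
  have h1 : ∑ i, p i * v i ≤ 1 := by
    rw [← hp.2]
    exact Finset.sum_le_sum fun i _ => mul_le_of_le_one_right (hp.1 i) (hv.2 i)
  have h2 : 0 ≤ v i := hv.1 i
  have h3 : 0 ≤ γ / 4 * ∑ i, p i * ∑ j, g x i j * (f x j - v j) ^ 2 :=
    mul_nonneg (by positivity) (Finset.sum_nonneg fun i _ => mul_nonneg (hp.1 i)
      (Finset.sum_nonneg fun j _ => mul_nonneg (hg i j) (sq_nonneg _)))
  dsimp only
  linarith

/-- The minimax value of the decision-estimation coefficient. -/
theorem exists_dec_le (hK : 2 ≤ K) (hγ : 4 ≤ γ) {q : FeedbackGraph K → ℝ}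
    (hq : q ∈ graphDistributions (g x)) :
    ∃ p ∈ stdSimplex ℝ (Fin K),
      dec γ p f g x ≤ (3 + 4 * meanIndepNum q * (1 + Real.log (K * γ))) / γ := by
  have : Nonempty (Fin K) := ⟨⟨0, by omega⟩⟩
  have : Nonempty (Set.Icc (0 : Fin K → ℝ) 1) := ⟨⟨0, le_rfl, zero_le_one⟩⟩
  obtain ⟨p, hp, hpB⟩ := exists_mem_stdSimplex_forall_sum_mul_le
    (fun (s : Fin K × Set.Icc (0 : Fin K → ℝ) 1) i =>
      s.2.1 i - s.2.1 s.1 - γ / 4 * ∑ j, g x i j * (f x j - s.2.1 j) ^ 2)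
    ((3 + 4 * meanIndepNum q * (1 + Real.log (K * γ))) / γ)
    fun u w hw => exists_strategy_of_prior hK hq (f x) hγ (fun s : u => s.1.1)
      (fun s : u => s.1.2.1) (fun s i => ⟨s.1.2.2.1 i, s.1.2.2.2 i⟩) hw
  refine ⟨p, hp, ciSup_le fun s => (le_of_eq ?_).trans (hpB s)⟩
  simp only [mul_sub, Finset.sum_sub_distrib, ← Finset.sum_mul, hp.2, one_mul]
  congr 1
  rw [Finset.mul_sum]
  exact Finset.sum_congr rfl fun i _ => by ring

/-- The supremum is tested at `v⋆ = v` and at an action `i⋆` minimising `v`. -/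
theorem sum_mul_sub_iInf_le_dec (hγ : 0 ≤ γ) (hg : ∀ i j, 0 ≤ g x i j) {p : Fin K → ℝ}
    (hp : p ∈ stdSimplex ℝ (Fin K)) {v : Fin K → ℝ} (hv : ∀ i, v i ∈ Set.Icc (0 : ℝ) 1) :
    ∑ i, p i * v i - ⨅ i, v i
      ≤ dec γ p f g x + γ / 4 * ∑ i, p i * ∑ j, g x i j * (f x j - v j) ^ 2 := by
  have : Nonempty (Fin K) := by
    by_contra h
    rw [not_nonempty_iff] at h
    exact absurd hp.2 (by simp)
  obtain ⟨i, hi⟩ := exists_eq_ciInf_of_finite (f := v)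
  have := le_ciSup (bddAbove_dec (f := f) hγ hg hp)
    (i, ⟨v, fun i => (hv i).1, fun i => (hv i).2⟩)
  rw [← hi]
  unfold dec
  linarith

/-- A uniform bound for minimisers of the decision-estimation coefficient. -/
theorem dec_le_of_isMinOn (hK : 2 ≤ K) (hγ : 4 ≤ γ) {𝒢 : Set (𝒳 → Fin K → Fin K → ℝ)}
    (h𝒢 : ∀ g ∈ 𝒢, ∀ x, (graphDistributions (g x)).Nonempty) (hg : g ∈ convexHull ℝ 𝒢)
    {p : Fin K → ℝ} (hp : IsMinOn (fun p => dec γ p f g x) (stdSimplex ℝ (Fin K)) p) :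
    dec γ p f g x ≤ 14 * alphaClass 𝒢 * (1 + Real.log (K * γ)) / γ := by
  have hK0 : 0 < K := by omega
  obtain ⟨q, hq, hqc⟩ := exists_graphDistribution_of_mem_convexHull hK0 h𝒢 hg x
  obtain ⟨p', hp', hle⟩ := exists_dec_le (f := f) hK hγ hq
  refine (hp hp').trans (hle.trans (div_le_div_of_nonneg_right ?_ (by linarith)))
  have h1 := one_le_meanIndepNum hK0 hq.1
  have hlog : 0 ≤ Real.log (K * γ) := by
    refine Real.log_nonneg (one_le_mul_of_one_le_of_one_le ?_ (by linarith))
    exact_mod_cast (by omega : 1 ≤ K)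
  have h2 : meanIndepNum q * (1 + Real.log (K * γ))
      ≤ 2 * alphaClass 𝒢 * (1 + Real.log (K * γ)) :=
    mul_le_mul_of_nonneg_right hqc (by linarith)
  -- Absorbs the additive 3: the numerator is at most 7 times this product, hence the constant `14 =
  -- 7 · 2`.
  have h3 : 1 ≤ meanIndepNum q * (1 + Real.log (K * γ)) :=
    one_le_mul_of_one_le_of_one_le h1 (by linarith)
  linarith

end Dec

/-! ### Conditional expectations -/

section CondExp

variable {Ω : Type*} {m m₀ : MeasurableSpace Ω} {μ : Measure Ω} [IsProbabilityMeasure μ]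

theorem integral_mul_of_condExp_ae_eq (hm : m ≤ m₀) {b c u : Ω → ℝ} (hb : Integrable b μ)
    (hbc : μ[b | m] =ᵐ[μ] c) (hu : AEStronglyMeasurable[m] u μ) {C : ℝ}
    (huC : ∀ᵐ ω ∂μ, ‖u ω‖ ≤ C) : ∫ ω, b ω * u ω ∂μ = ∫ ω, c ω * u ω ∂μ := by
  have h1 := condExp_stronglyMeasurable_mul_of_bound₀ hm hu hb C huC
  calc ∫ ω, b ω * u ω ∂μ = ∫ ω, (u * b) ω ∂μ :=
        integral_congr_ae (Filter.Eventually.of_forall fun ω => mul_comm _ _)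
    _ = ∫ ω, (μ[u * b | m]) ω ∂μ := (integral_condExp hm).symm
    _ = ∫ ω, c ω * u ω ∂μ := by
      refine integral_congr_ae ?_
      filter_upwards [h1, hbc] with ω h1 h2
      rw [h1, Pi.mul_apply, h2, mul_comm]

/-- The pull-out property for an unbounded `u`, as needed for likelihood ratios. The densities `b`
and `μ[b | m]` define the same measure on `m`, so `m`-measurable functions have the same lower
integral against both. -/
theorem lintegral_mul_of_condExp_ae_eq (hm : m ≤ m₀) {b c u : Ω → ℝ} (hb : Integrable b μ)
    (hb0 : 0 ≤ᵐ[μ] b) (hbc : μ[b | m] =ᵐ[μ] c) (hu : AEStronglyMeasurable[m] u μ) :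
    ∫⁻ ω, ENNReal.ofReal (b ω) * ENNReal.ofReal (u ω) ∂μ
      = ∫⁻ ω, ENNReal.ofReal (c ω) * ENNReal.ofReal (u ω) ∂μ := by
  set c' : Ω → ℝ := μ[b | m] with hc'
  have hc'm : StronglyMeasurable[m] c' := stronglyMeasurable_condExp
  have hc'0 : 0 ≤ᵐ[μ] c' := condExp_nonneg hb0
  have hbm : AEMeasurable (fun ω => ENNReal.ofReal (b ω)) μ := hb.aemeasurable.ennreal_ofReal
  have hcm : AEMeasurable (fun ω => ENNReal.ofReal (c' ω)) μ :=
    (hc'm.measurable.mono hm le_rfl).ennreal_ofReal.aemeasurable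
  obtain ⟨u', hu', huu'⟩ := hu
  have hw : Measurable[m] fun ω => ENNReal.ofReal (u' ω) := hu'.measurable.ennreal_ofReal
  have htrim : (μ.withDensity fun ω => ENNReal.ofReal (b ω)).trim hm
      = (μ.withDensity fun ω => ENNReal.ofReal (c' ω)).trim hm := by
    refine @Measure.ext _ m _ _ fun s hs => ?_
    rw [trim_measurableSet_eq hm hs, trim_measurableSet_eq hm hs, withDensity_apply _ (hm s hs),
      withDensity_apply _ (hm s hs),
      ← ofReal_integral_eq_lintegral_ofReal hb.integrableOn (ae_restrict_of_ae hb0),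
      ← ofReal_integral_eq_lintegral_ofReal integrable_condExp.integrableOn
        (ae_restrict_of_ae hc'0), setIntegral_condExp hm hb hs]
  calc ∫⁻ ω, ENNReal.ofReal (b ω) * ENNReal.ofReal (u ω) ∂μ
      = ∫⁻ ω, ENNReal.ofReal (b ω) * ENNReal.ofReal (u' ω) ∂μ := by
        refine lintegral_congr_ae ?_
        filter_upwards [huu'] with ω h
        rw [h]
    _ = ∫⁻ ω, ENNReal.ofReal (u' ω) ∂(μ.withDensity fun ω => ENNReal.ofReal (b ω)) :=
        (lintegral_withDensity_eq_lintegral_mul₀ hbm (hw.mono hm le_rfl).aemeasurable).symm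
    _ = ∫⁻ ω, ENNReal.ofReal (u' ω) ∂(μ.withDensity fun ω => ENNReal.ofReal (c' ω)) := by
        rw [← lintegral_trim hm hw, htrim, lintegral_trim hm hw]
    _ = ∫⁻ ω, ENNReal.ofReal (c' ω) * ENNReal.ofReal (u' ω) ∂μ :=
        lintegral_withDensity_eq_lintegral_mul₀ hcm (hw.mono hm le_rfl).aemeasurable
    _ = ∫⁻ ω, ENNReal.ofReal (c ω) * ENNReal.ofReal (u ω) ∂μ := by
        refine lintegral_congr_ae ?_
        filter_upwards [huu', hbc] with ω h h'
        rw [h, h']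

/-- A nonnegative variable vanishes where its conditional expectation is not positive. -/
theorem ae_pos_of_condExp_ae_eq (hm : m ≤ m₀) {b c : Ω → ℝ} (hb : Integrable b μ)
    (hb0 : 0 ≤ᵐ[μ] b) (hbc : μ[b | m] =ᵐ[μ] c) : ∀ᵐ ω ∂μ, 0 < b ω → 0 < c ω := by
  -- The test function is the indicator of the set where the conditional expectation is not
  -- positive.
  have hmeas : Measurable[m] fun ω => if (μ[b | m]) ω ≤ 0 then (1 : ℝ) else 0 :=
    Measurable.ite (measurableSet_le stronglyMeasurable_condExp.measurable measurable_const)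
      measurable_const measurable_const
  have h := lintegral_mul_of_condExp_ae_eq hm hb hb0 hbc hmeas.aestronglyMeasurable
  have h0 : ∫⁻ ω, ENNReal.ofReal (c ω) *
      ENNReal.ofReal (if (μ[b | m]) ω ≤ 0 then (1 : ℝ) else 0) ∂μ = 0 := by
    rw [lintegral_eq_zero_of_ae_eq_zero]
    filter_upwards [hbc] with ω hω
    by_cases hle : (μ[b | m]) ω ≤ 0
    · simp [ENNReal.ofReal_eq_zero.2 (hω ▸ hle)]
    · simp [hle]
  rw [h0, lintegral_eq_zero_iff'] at h
  · filter_upwards [h, hbc] with ω h1 h2 hpos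
    by_contra hc
    rw [← h2] at hc
    simp [not_lt.1 hc, hpos.not_ge] at h1
  · exact hb.aemeasurable.ennreal_ofReal.mul
      (hmeas.mono hm le_rfl).ennreal_ofReal.aemeasurable

/-- The expected square root of a likelihood ratio. -/
theorem lintegral_mul_sqrt_div (hm : m ≤ m₀) {b p c g : Ω → ℝ} (hb : Integrable b μ)
    (hb0 : 0 ≤ᵐ[μ] b) (hbc : μ[b | m] =ᵐ[μ] fun ω => p ω * c ω)
    (hc : AEStronglyMeasurable[m] c μ) (hg : AEStronglyMeasurable[m] g μ)
    (hp0 : 0 ≤ᵐ[μ] p) (hc0 : 0 ≤ᵐ[μ] c) (hg0 : 0 ≤ᵐ[μ] g) :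
    ∫⁻ ω, ENNReal.ofReal (b ω * √(g ω / c ω)) ∂μ
      = ∫⁻ ω, ENNReal.ofReal (p ω * √(g ω * c ω)) ∂μ := by
  have hu : AEStronglyMeasurable[m] (fun ω => √(g ω / c ω)) μ := by
    obtain ⟨c', hc', hcc⟩ := hc
    obtain ⟨g', hg', hgg⟩ := hg
    refine ⟨fun ω => √(g' ω / c' ω),
      (hg'.measurable.div hc'.measurable).sqrt.stronglyMeasurable, ?_⟩
    filter_upwards [hcc, hgg] with ω h1 h2
    rw [h1, h2]
  have h := lintegral_mul_of_condExp_ae_eq hm hb hb0 hbc hu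
  calc _ = ∫⁻ ω, ENNReal.ofReal (b ω) * ENNReal.ofReal (√(g ω / c ω)) ∂μ := by
        refine lintegral_congr_ae ?_
        filter_upwards [hb0] with ω h
        rw [ENNReal.ofReal_mul h]
    _ = _ := h
    _ = _ := by
        refine lintegral_congr_ae ?_
        filter_upwards [hp0, hc0, hg0] with ω h1 h2 h3
        rw [Pi.zero_apply] at h1 h2 h3
        rw [← ENNReal.ofReal_mul (mul_nonneg h1 h2), mul_assoc]
        congr 2
        -- The identity `c √(g / c) = √(g c)` survives `c = 0`, where both sides vanish.
        rcases h2.eq_or_lt with h0 | h0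
        · simp [← h0]
        · rw [Real.sqrt_div h3, Real.sqrt_mul h3]
          have := Real.mul_self_sqrt h2
          have hne : √(c ω) ≠ 0 := (Real.sqrt_pos.2 h0).ne'
          rw [mul_div_assoc', div_eq_iff hne]
          linear_combination (-√(g ω)) * this

end CondExp

/-! ### Conditional moments of one round -/

namespace Interaction

variable {Ω : Type*} {m₀ : MeasurableSpace Ω} {𝒳 : Type*} {K T : ℕ}
  {I : Interaction Ω 𝒳 K T} {μ : Measure Ω}

/-- The indicator of the event that action `i` is drawn in round `t`. -/
def draw (I : Interaction Ω 𝒳 K T) (t : Fin T) (i : Fin K) (ω : Ω) : ℝ :=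
  if I.action t ω = i then 1 else 0

theorem draw_nonneg (t : Fin T) (i : Fin K) (ω : Ω) : 0 ≤ I.draw t i ω := by
  unfold draw; split_ifs <;> norm_num

theorem draw_le_one (t : Fin T) (i : Fin K) (ω : Ω) : I.draw t i ω ≤ 1 := by
  unfold draw; split_ifs <;> norm_num

theorem sum_draw_mul (t : Fin T) (ω : Ω) (z : Fin K → ℝ) :
    ∑ i, I.draw t i ω * z i = z (I.action t ω) := by
  simp [draw]

theorem info_le_infoWithEnv (t : Fin T) : I.info t ≤ I.infoWithEnv t :=
  le_sup_left.trans le_sup_left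

theorem measurable_adj (t : Fin T) (i j : Fin K) :
    Measurable[I.infoWithEnv t] fun ω => (I.graph t ω).adj i j := by
  have h1 : Measurable[MeasurableSpace.comap (I.graph t) ⊤, ⊤] (I.graph t) :=
    comap_measurable _
  have h2 : Measurable[⊤] fun G : FeedbackGraph K => G.adj i j := measurable_from_top
  exact (h2.comp h1).mono le_sup_right le_rfl

theorem measurable_loss (t : Fin T) (j : Fin K) :
    Measurable[I.infoWithEnv t] fun ω => I.loss t ω j := by
  have h1 : Measurable[MeasurableSpace.comap (I.loss t) inferInstance] (I.loss t) :=
    comap_measurable _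
  exact ((measurable_pi_apply j).comp h1).mono (le_sup_right.trans le_sup_left) le_rfl

namespace FollowsProtocol

variable [MeasurableSpace 𝒳]

theorem infoWithEnv_le (h : I.FollowsProtocol μ) (t : Fin T) : I.infoWithEnv t ≤ m₀ :=
  sup_le (sup_le (I.info.le t) (h.loss_meas t).comap_le) (h.graph_meas t).comap_le

theorem measurable_draw (h : I.FollowsProtocol μ) (t : Fin T) (i : Fin K) :
    Measurable (I.draw t i) :=
  (measurable_of_finite fun k : Fin K => if k = i then (1 : ℝ) else 0).comp (h.action_meas t)

theorem ae_adj_mul_loss_le_one (h : I.FollowsProtocol μ) (t : Fin T) (i j : Fin K) :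
    ∀ᵐ ω ∂μ, ‖(I.graph t ω).adj i j * I.loss t ω j‖ ≤ 1 := by
  filter_upwards [h.loss_mem t] with ω hω
  rw [Real.norm_of_nonneg (mul_nonneg (FeedbackGraph.adj_nonneg _ _ _) (hω j).1)]
  exact mul_le_one₀ (FeedbackGraph.adj_le_one _ _ _) (hω j).1 (hω j).2

theorem ae_strategy_le_one (h : I.FollowsProtocol μ) (t : Fin T) (i : Fin K) :
    ∀ᵐ ω ∂μ, ‖I.strategy t ω i‖ ≤ 1 := by
  filter_upwards [h.strategy_mem t] with ω hω
  rw [Real.norm_of_nonneg (hω.1 i), ← hω.2]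
  exact Finset.single_le_sum (fun i _ => hω.1 i) (Finset.mem_univ i)

variable [IsProbabilityMeasure μ]

/-- The draw of the action is independent of the environment given the past. -/
theorem condExp_draw_mul (h : I.FollowsProtocol μ) (t : Fin T) (i : Fin K) {Y c : Ω → ℝ}
    (hY : Measurable[I.infoWithEnv t] Y) (hY1 : ∀ᵐ ω ∂μ, ‖Y ω‖ ≤ 1)
    (hc : μ[Y | I.info t] =ᵐ[μ] c) :
    μ[fun ω => I.draw t i ω * Y ω | I.info t] =ᵐ[μ] fun ω => I.strategy t ω i * c ω := by
  have hle := h.infoWithEnv_le t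
  have hYi : Integrable Y μ :=
    Integrable.of_bound (hY.mono hle le_rfl).aestronglyMeasurable 1 hY1
  have hdi : Integrable (I.draw t i) μ :=
    Integrable.of_bound (h.measurable_draw t i).aestronglyMeasurable 1 (Filter.Eventually.of_forall
      fun ω => by rw [Real.norm_of_nonneg (draw_nonneg t i ω)]; exact draw_le_one t i ω)
  -- Tower property: given the environment, `Y` is known and the draw averages to the strategy;
  -- given only the past, the strategy is known and `Y` averages to `c`.
  have h1 : μ[fun ω => I.draw t i ω * Y ω | I.infoWithEnv t]
      =ᵐ[μ] fun ω => I.strategy t ω i * Y ω := by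
    have e : (fun ω => I.draw t i ω * Y ω) = Y * I.draw t i := by
      funext ω; exact mul_comm _ _
    rw [e]
    refine (condExp_stronglyMeasurable_mul_of_bound hle hY.stronglyMeasurable hdi 1 hY1).trans ?_
    filter_upwards [h.action_law t i] with ω hω
    rw [Pi.mul_apply, mul_comm]
    congr 1
  have h2 : μ[fun ω => I.strategy t ω i * Y ω | I.info t]
      =ᵐ[μ] fun ω => I.strategy t ω i * c ω := by
    refine (condExp_stronglyMeasurable_mul_of_bound (I.info.le t)
      ((measurable_pi_apply i).comp (h.strategy_meas t)).stronglyMeasurable hYi 1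
      (h.ae_strategy_le_one t i)).trans ?_
    filter_upwards [hc] with ω hω
    rw [Pi.mul_apply, hω]; rfl
  exact (condExp_condExp_of_le (info_le_infoWithEnv t) hle).symm.trans
    ((condExp_congr_ae h1).trans h2)

theorem integrable_draw_mul (h : I.FollowsProtocol μ) (t : Fin T) (i : Fin K) {Y : Ω → ℝ}
    (hY : Measurable[I.infoWithEnv t] Y) (hY1 : ∀ᵐ ω ∂μ, ‖Y ω‖ ≤ 1) :
    Integrable (fun ω => I.draw t i ω * Y ω) μ := by
  refine Integrable.of_bound ((h.measurable_draw t i).mul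
    (hY.mono (h.infoWithEnv_le t) le_rfl)).aestronglyMeasurable 1 ?_
  filter_upwards [hY1] with ω hω
  rw [norm_mul, Real.norm_of_nonneg (draw_nonneg t i ω)]
  exact mul_le_one₀ (draw_le_one t i ω) (norm_nonneg _) hω

theorem integral_draw_mul_mul (h : I.FollowsProtocol μ) (t : Fin T) (i : Fin K) {Y c u : Ω → ℝ}
    (hY : Measurable[I.infoWithEnv t] Y) (hY1 : ∀ᵐ ω ∂μ, ‖Y ω‖ ≤ 1)
    (hc : μ[Y | I.info t] =ᵐ[μ] c) (hu : AEStronglyMeasurable[I.info t] u μ) {C : ℝ}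
    (huC : ∀ᵐ ω ∂μ, ‖u ω‖ ≤ C) :
    ∫ ω, I.draw t i ω * Y ω * u ω ∂μ = ∫ ω, I.strategy t ω i * c ω * u ω ∂μ :=
  integral_mul_of_condExp_ae_eq (I.info.le t) (h.integrable_draw_mul t i hY hY1)
    (h.condExp_draw_mul t i hY hY1 hc) hu huC

end FollowsProtocol

theorem MeanLoss.aestronglyMeasurable {fstar : 𝒳 → Fin K → ℝ} (h : I.MeanLoss μ fstar)
    (t : Fin T) (i : Fin K) :
    AEStronglyMeasurable[I.info t] (fun ω => fstar (I.context t ω) i) μ :=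
  ⟨_, stronglyMeasurable_condExp, (h t i).symm⟩

theorem MeanGraph.aestronglyMeasurable {gstar : 𝒳 → Fin K → Fin K → ℝ} (h : I.MeanGraph μ gstar)
    (t : Fin T) (i j : Fin K) :
    AEStronglyMeasurable[I.info t] (fun ω => gstar (I.context t ω) i j) μ :=
  ⟨_, stronglyMeasurable_condExp, (h t i j).symm⟩

end Interaction

namespace Interaction

variable {Ω : Type*} {m₀ : MeasurableSpace Ω} {𝒳 : Type*} {K T : ℕ}
  {I : Interaction Ω 𝒳 K T} {μ : Measure Ω}

theorem ae_norm_adj_le_one (t : Fin T) (i j : Fin K) :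
    ∀ᵐ ω ∂μ, ‖(I.graph t ω).adj i j‖ ≤ 1 :=
  Filter.Eventually.of_forall fun ω => by
    rw [Real.norm_of_nonneg (FeedbackGraph.adj_nonneg _ _ _)]
    exact FeedbackGraph.adj_le_one _ _ _

namespace FollowsProtocol

variable [MeasurableSpace 𝒳] [IsProbabilityMeasure μ]

theorem integrable_adj (h : I.FollowsProtocol μ) (t : Fin T) (i j : Fin K) :
    Integrable (fun ω => (I.graph t ω).adj i j) μ :=
  Integrable.of_bound
    ((measurable_adj t i j).mono (h.infoWithEnv_le t) le_rfl).aestronglyMeasurable 1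
    (ae_norm_adj_le_one t i j)

theorem condExp_one_sub_adj (h : I.FollowsProtocol μ) (t : Fin T) (i j : Fin K) {c : Ω → ℝ}
    (hc : μ[fun ω => (I.graph t ω).adj i j | I.info t] =ᵐ[μ] c) :
    μ[fun ω => 1 - (I.graph t ω).adj i j | I.info t] =ᵐ[μ] fun ω => 1 - c ω := by
  refine (condExp_sub (integrable_const (1 : ℝ)) (h.integrable_adj t i j) (I.info t)).trans ?_
  rw [condExp_const (I.info.le t)]
  filter_upwards [hc] with ω hω
  rw [Pi.sub_apply, hω]

theorem integrable_draw_mul_mul (h : I.FollowsProtocol μ) (t : Fin T) (i : Fin K) {Y u : Ω → ℝ}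
    (hY : Measurable[I.infoWithEnv t] Y) (hY1 : ∀ᵐ ω ∂μ, ‖Y ω‖ ≤ 1)
    (hu : AEStronglyMeasurable[I.info t] u μ) {C : ℝ} (huC : ∀ᵐ ω ∂μ, ‖u ω‖ ≤ C) :
    Integrable (fun ω => I.draw t i ω * Y ω * u ω) μ :=
  (h.integrable_draw_mul t i hY hY1).mul_bdd (hu.mono (I.info.le t)) huC

theorem integrable_strategy_mul (h : I.FollowsProtocol μ) (t : Fin T) (i : Fin K) {u : Ω → ℝ}
    (hu : AEStronglyMeasurable[I.info t] u μ) {C : ℝ} (huC : ∀ᵐ ω ∂μ, ‖u ω‖ ≤ C) :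
    Integrable (fun ω => I.strategy t ω i * u ω) μ := by
  have hs : Measurable fun ω => I.strategy t ω i :=
    ((measurable_pi_apply i).comp (h.strategy_meas t)).mono (I.info.le t) le_rfl
  exact (Integrable.of_bound hs.aestronglyMeasurable 1 (h.ae_strategy_le_one t i)).mul_bdd
    (hu.mono (I.info.le t)) huC

/-- The mean of a function of the action drawn in round `t`. -/
theorem integral_apply_action (h : I.FollowsProtocol μ) (t : Fin T) {u : Ω → Fin K → ℝ}
    (hu : ∀ i, AEStronglyMeasurable[I.info t] (fun ω => u ω i) μ) {C : ℝ}
    (huC : ∀ i, ∀ᵐ ω ∂μ, ‖u ω i‖ ≤ C) :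
    Integrable (fun ω => u ω (I.action t ω)) μ ∧
      ∫ ω, u ω (I.action t ω) ∂μ = ∫ ω, ∑ i, I.strategy t ω i * u ω i ∂μ := by
  have hc : μ[fun _ => (1 : ℝ) | I.info t] =ᵐ[μ] fun _ => (1 : ℝ) := by
    rw [condExp_const (I.info.le t)]
  have h1 : ∀ᵐ _ ∂μ, ‖(1 : ℝ)‖ ≤ 1 := Filter.Eventually.of_forall fun _ => by simp
  have e : (fun ω => u ω (I.action t ω)) = fun ω => ∑ i, I.draw t i ω * 1 * u ω i := by
    funext ω
    simp only [mul_one]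
    exact (sum_draw_mul t ω (u ω)).symm
  have hi : ∀ i ∈ Finset.univ, Integrable (fun ω => I.draw t i ω * 1 * u ω i) μ := fun i _ =>
    h.integrable_draw_mul_mul t i measurable_const h1 (hu i) (huC i)
  rw [e]
  refine ⟨integrable_finsetSum _ hi, ?_⟩
  rw [integral_finsetSum _ hi,
    integral_finsetSum _ fun i _ => h.integrable_strategy_mul t i (hu i) (huC i)]
  refine Finset.sum_congr rfl fun i _ => ?_
  rw [h.integral_draw_mul_mul t i measurable_const h1 hc (hu i) (huC i)]
  simp

/-- The expected excess squared loss on an observed entry. -/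
theorem integral_draw_mul_adj_mul_sq_sub_sq (h : I.FollowsProtocol μ)
    (hU : I.EdgesUncorrelatedWithLosses μ) (t : Fin T) (i j : Fin K) {a s c : Ω → ℝ}
    (ha : AEStronglyMeasurable[I.info t] a μ) (ha1 : ∀ᵐ ω ∂μ, a ω ∈ Set.Icc (0 : ℝ) 1)
    (hs1 : ∀ᵐ ω ∂μ, s ω ∈ Set.Icc (0 : ℝ) 1)
    (hs : μ[fun ω => I.loss t ω j | I.info t] =ᵐ[μ] s)
    (hc : μ[fun ω => (I.graph t ω).adj i j | I.info t] =ᵐ[μ] c) :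
    Integrable (fun ω => I.draw t i ω * ((I.graph t ω).adj i j *
        ((a ω - I.loss t ω j) ^ 2 - (s ω - I.loss t ω j) ^ 2))) μ ∧
      ∫ ω, I.draw t i ω * ((I.graph t ω).adj i j *
        ((a ω - I.loss t ω j) ^ 2 - (s ω - I.loss t ω j) ^ 2)) ∂μ
      = ∫ ω, I.strategy t ω i * (c ω * (a ω - s ω) ^ 2) ∂μ := by
  have hsm : AEStronglyMeasurable[I.info t] s μ := ⟨_, stronglyMeasurable_condExp, hs.symm⟩
  have hadj1 := ae_norm_adj_le_one (I := I) (μ := μ) t i j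
  -- Here uncorrelatedness enters: the conditional mean of the excess is `c (a² - s²) - 2 c s (a -
  -- s) = c (a - s)²`.
  have hcl : μ[fun ω => (I.graph t ω).adj i j * I.loss t ω j | I.info t]
      =ᵐ[μ] fun ω => c ω * s ω := by
    filter_upwards [hU t i j, hs, hc] with ω h1 h2 h3
    rw [h1, h2, h3]
  have hY1 := measurable_adj (I := I) t i j
  have hY2 : Measurable[I.infoWithEnv t] fun ω => (I.graph t ω).adj i j * I.loss t ω j :=
    hY1.mul (measurable_loss t j)
  have hu1 : AEStronglyMeasurable[I.info t] (fun ω => a ω ^ 2 - s ω ^ 2) μ :=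
    (ha.pow 2).sub (hsm.pow 2)
  have hu2 : AEStronglyMeasurable[I.info t] (fun ω => 2 * (a ω - s ω)) μ :=
    (ha.sub hsm).const_mul 2
  have hb1 : ∀ᵐ ω ∂μ, ‖a ω ^ 2 - s ω ^ 2‖ ≤ 2 := by
    filter_upwards [ha1, hs1] with ω h1 h2
    rw [Real.norm_eq_abs, abs_le]
    constructor <;> nlinarith [h1.1, h1.2, h2.1, h2.2]
  have hb2 : ∀ᵐ ω ∂μ, ‖2 * (a ω - s ω)‖ ≤ 2 := by
    filter_upwards [ha1, hs1] with ω h1 h2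
    rw [Real.norm_eq_abs, abs_le]
    constructor <;> linarith [h1.1, h1.2, h2.1, h2.2]
  have hi1 := h.integrable_draw_mul_mul t i hY1 hadj1 hu1 hb1
  have hi2 := h.integrable_draw_mul_mul t i hY2 (h.ae_adj_mul_loss_le_one t i j) hu2 hb2
  -- The squares of the loss cancel, so only its first moment is needed.
  have e : (fun ω => I.draw t i ω * ((I.graph t ω).adj i j *
        ((a ω - I.loss t ω j) ^ 2 - (s ω - I.loss t ω j) ^ 2)))
      = fun ω => I.draw t i ω * (I.graph t ω).adj i j * (a ω ^ 2 - s ω ^ 2)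
        - I.draw t i ω * ((I.graph t ω).adj i j * I.loss t ω j) * (2 * (a ω - s ω)) := by
    funext ω; ring
  rw [e]
  refine ⟨hi1.sub hi2, ?_⟩
  have hcm : AEStronglyMeasurable[I.info t] c μ := ⟨_, stronglyMeasurable_condExp, hc.symm⟩
  have hcb : ∀ᵐ ω ∂μ, ‖c ω‖ ≤ 1 := by
    have := ae_bdd_abs_condExp_of_ae_bdd_abs (m := I.info t) (R := (1 : ℝ)) (f := fun ω =>
      (I.graph t ω).adj i j) (μ := μ) hadj1
    filter_upwards [this, hc] with ω h1 h2
    rw [← h2]; exact h1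
  have hj1 : Integrable (fun ω => I.strategy t ω i * (c ω * (a ω ^ 2 - s ω ^ 2))) μ := by
    refine h.integrable_strategy_mul t i (hcm.mul hu1) (C := 1 * 2) ?_
    filter_upwards [hcb, hb1] with ω h1 h2
    rw [norm_mul]
    exact mul_le_mul h1 h2 (norm_nonneg _) zero_le_one
  have hj2 : Integrable (fun ω => I.strategy t ω i * (c ω * s ω * (2 * (a ω - s ω)))) μ := by
    refine h.integrable_strategy_mul t i ((hcm.mul hsm).mul hu2) (C := 1 * 1 * 2) ?_
    filter_upwards [hcb, hb2, hs1] with ω h1 h2 h3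
    rw [norm_mul, norm_mul]
    have h4 : ‖s ω‖ ≤ 1 := by rw [Real.norm_of_nonneg h3.1]; exact h3.2
    exact mul_le_mul (mul_le_mul h1 h4 (norm_nonneg _) zero_le_one) h2 (norm_nonneg _)
      (by norm_num)
  rw [integral_sub hi1 hi2, h.integral_draw_mul_mul t i hY1 hadj1 hc hu1 hb1,
    h.integral_draw_mul_mul t i hY2 (h.ae_adj_mul_loss_le_one t i j) hcl hu2 hb2]
  simp only [mul_assoc] at hj1 hj2 ⊢
  rw [← integral_sub hj1 hj2]
  exact integral_congr_ae (Filter.Eventually.of_forall fun ω => by ring)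

/-- The expected square root of the likelihood ratio of an entry of the graph. -/
theorem lintegral_draw_mul_adj_mul_sqrt (h : I.FollowsProtocol μ) (t : Fin T) (i j : Fin K)
    {c g : Ω → ℝ} (hc : μ[fun ω => (I.graph t ω).adj i j | I.info t] =ᵐ[μ] c)
    (hg : AEStronglyMeasurable[I.info t] g μ)
    (hc1 : ∀ᵐ ω ∂μ, c ω ∈ Set.Icc (0 : ℝ) 1) (hg1 : ∀ᵐ ω ∂μ, g ω ∈ Set.Icc (0 : ℝ) 1) :
    ∫⁻ ω, ENNReal.ofReal (I.draw t i ω * (I.graph t ω).adj i j * √(g ω / c ω)) ∂μ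
        = ∫⁻ ω, ENNReal.ofReal (I.strategy t ω i * √(g ω * c ω)) ∂μ ∧
      ∫⁻ ω, ENNReal.ofReal (I.draw t i ω * (1 - (I.graph t ω).adj i j) *
          √((1 - g ω) / (1 - c ω))) ∂μ
        = ∫⁻ ω, ENNReal.ofReal (I.strategy t ω i * √((1 - g ω) * (1 - c ω))) ∂μ := by
  have hadj := measurable_adj (I := I) t i j
  have hadj1 := ae_norm_adj_le_one (I := I) (μ := μ) t i j
  have hadj2 : ∀ᵐ ω ∂μ, ‖1 - (I.graph t ω).adj i j‖ ≤ 1 :=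
    Filter.Eventually.of_forall fun ω => by
      have h0 := FeedbackGraph.adj_nonneg (I.graph t ω) i j
      have h1 := FeedbackGraph.adj_le_one (I.graph t ω) i j
      rw [Real.norm_of_nonneg (by linarith)]
      linarith
  have hcm : AEStronglyMeasurable[I.info t] c μ := ⟨_, stronglyMeasurable_condExp, hc.symm⟩
  have hp0 : 0 ≤ᵐ[μ] fun ω => I.strategy t ω i := by
    filter_upwards [h.strategy_mem t] with ω hω using hω.1 i
  have hone : AEStronglyMeasurable[I.info t] (fun _ : Ω => (1 : ℝ)) μ :=
    stronglyMeasurable_const.aestronglyMeasurable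
  have hc' := h.condExp_one_sub_adj t i j hc
  constructor
  · refine lintegral_mul_sqrt_div (I.info.le t) (h.integrable_draw_mul t i hadj hadj1)
      (Filter.Eventually.of_forall fun ω => mul_nonneg (draw_nonneg t i ω)
        (FeedbackGraph.adj_nonneg _ _ _))
      (h.condExp_draw_mul t i hadj hadj1 hc) hcm hg hp0 ?_ ?_
    · filter_upwards [hc1] with ω hω using hω.1
    · filter_upwards [hg1] with ω hω using hω.1
  · refine lintegral_mul_sqrt_div (I.info.le t)
      (h.integrable_draw_mul t i (hadj.const_sub 1) hadj2)
      (Filter.Eventually.of_forall fun ω => mul_nonneg (draw_nonneg t i ω)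
        (sub_nonneg.2 (FeedbackGraph.adj_le_one _ _ _)))
      (h.condExp_draw_mul t i (hadj.const_sub 1) hadj2 hc') (hone.sub hcm) (hone.sub hg) hp0 ?_ ?_
    · filter_upwards [hc1] with ω hω using sub_nonneg.2 hω.2
    · filter_upwards [hg1] with ω hω using sub_nonneg.2 hω.2

/-- Almost surely, the realised value of an entry of the graph has positive mean. -/
theorem ae_mean_pos (h : I.FollowsProtocol μ) (t : Fin T) (i j : Fin K)
    {c : Ω → ℝ} (hc : μ[fun ω => (I.graph t ω).adj i j | I.info t] =ᵐ[μ] c) :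
    ∀ᵐ ω ∂μ, 0 < if (i, j) ∈ I.graph t ω then c ω else 1 - c ω := by
  have hadji := h.integrable_adj t i j
  have hc' := h.condExp_one_sub_adj t i j hc
  filter_upwards [ae_pos_of_condExp_ae_eq (I.info.le t) hadji
      (Filter.Eventually.of_forall fun ω => FeedbackGraph.adj_nonneg _ _ _) hc,
    ae_pos_of_condExp_ae_eq (I.info.le t) ((integrable_const 1).sub hadji)
      (Filter.Eventually.of_forall fun ω => sub_nonneg.2 (FeedbackGraph.adj_le_one _ _ _)) hc']
    with ω h1 h2
  by_cases hij : (i, j) ∈ I.graph t ω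
  · rw [if_pos hij]; exact h1 (by simp [FeedbackGraph.adj, hij])
  · rw [if_neg hij]; exact h2 (by simp [FeedbackGraph.adj, hij])

end FollowsProtocol

end Interaction

/-! ### Log loss and likelihood ratios -/

theorem logLoss_adj {K : ℕ} (G : FeedbackGraph K) (i j : Fin K) (u : ℝ) :
    logLoss u (G.adj i j) = logInv (if (i, j) ∈ G then u else 1 - u) := by
  by_cases h : (i, j) ∈ G <;> simp [logLoss, FeedbackGraph.adj, h]

theorem logInv_ne_top {u : ℝ} (hu : 0 < u) : logInv u ≠ ⊤ := by
  simp [logInv, hu.not_ge]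

/-- This is `log z ≤ z - 1` at `z = √(q / r)`, doubled. For `q ≤ 0` the right-hand side is infinite.
-/
theorem logInv_add_two_le {q r : ℝ} (hq : q ≤ 1) (hr : 0 < r) (hr1 : r ≤ 1) :
    logInv r + 2 ≤ logInv q + ENNReal.ofReal (2 * √(q / r)) := by
  rcases le_or_gt q 0 with hq0 | hq0
  · simp [logInv, hq0]
  rw [logInv, logInv, if_neg hr.not_ge, if_neg hq0.not_ge,
    ← ENNReal.ofReal_add (Real.log_nonneg ((one_le_div hq0).2 hq)) (by positivity),
    show (2 : ENNReal) = ENNReal.ofReal 2 by simp,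
    ← ENNReal.ofReal_add (Real.log_nonneg ((one_le_div hr).2 hr1)) (by norm_num)]
  refine ENNReal.ofReal_le_ofReal ?_
  have hd : 0 < q / r := div_pos hq0 hr
  have h1 := Real.log_le_sub_one_of_pos (Real.sqrt_pos.2 hd)
  rw [Real.log_sqrt hd.le, Real.log_div hq0.ne' hr.ne'] at h1
  rw [one_div, one_div, Real.log_inv, Real.log_inv]
  linarith

/-! ### From oracle regret to estimation error -/

namespace Interaction

variable {Ω : Type*} {m₀ : MeasurableSpace Ω} {𝒳 : Type*} {K T : ℕ}
  {I : Interaction Ω 𝒳 K T} {μ : Measure Ω}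

theorem SqOracle.ae_lossEst_mem {F : Set (𝒳 → Fin K → ℝ)} {RegSq : ℝ} (h : I.SqOracle μ F RegSq)
    (hF : ∀ f ∈ F, ∀ x i, f x i ∈ Set.Icc (0 : ℝ) 1) (t : Fin T) :
    ∀ᵐ ω ∂μ, ∀ j, I.lossEst t ω (I.context t ω) j ∈ Set.Icc (0 : ℝ) 1 := by
  filter_upwards [h.mem_conv t] with ω hω j
  refine convexHull_min (t := {f : 𝒳 → Fin K → ℝ | f (I.context t ω) j ∈ Set.Icc (0 : ℝ) 1})
    (fun f hf => hF f hf _ _) ?_ hω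
  intro f hf f' hf' a b ha hb hab
  exact convex_Icc (0 : ℝ) 1 hf hf' ha hb hab

theorem LogOraclePartial.ae_graphEst_mem {𝒢 : Set (𝒳 → Fin K → Fin K → ℝ)} {RegLog : ℝ}
    (h : I.LogOraclePartial μ 𝒢 RegLog)
    (h𝒢 : ∀ g ∈ 𝒢, ∀ x i j, g x i j ∈ Set.Icc (0 : ℝ) 1) (t : Fin T) :
    ∀ᵐ ω ∂μ, ∀ i j, I.graphEst t ω (I.context t ω) i j ∈ Set.Icc (0 : ℝ) 1 := by
  filter_upwards [h.mem_conv t] with ω hω i j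
  refine convexHull_min
    (t := {g : 𝒳 → Fin K → Fin K → ℝ | g (I.context t ω) i j ∈ Set.Icc (0 : ℝ) 1})
    (fun g hg => h𝒢 g hg _ _ _) ?_ hω
  intro g hg g' hg' a b ha hb hab
  exact convex_Icc (0 : ℝ) 1 hg hg' ha hb hab

variable [MeasurableSpace 𝒳] [IsProbabilityMeasure μ]

/-- The squared-loss regret controls the estimation error on the observed entries. -/
theorem SqOracle.sum_integral_le {F : Set (𝒳 → Fin K → ℝ)} {RegSq : ℝ}
    (h : I.SqOracle μ F RegSq) (hP : I.FollowsProtocol μ)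
    (hF : ∀ f ∈ F, ∀ x i, f x i ∈ Set.Icc (0 : ℝ) 1)
    {fstar : 𝒳 → Fin K → ℝ} (hf : fstar ∈ F) (hL : I.MeanLoss μ fstar)
    {gstar : 𝒳 → Fin K → Fin K → ℝ} (hG : I.MeanGraph μ gstar)
    (hU : I.EdgesUncorrelatedWithLosses μ) :
    ∑ t, ∑ i, ∑ j, ∫ ω, I.strategy t ω i * (gstar (I.context t ω) i j *
      (I.lossEst t ω (I.context t ω) j - fstar (I.context t ω) j) ^ 2) ∂μ ≤ RegSq := by
  have key := fun (t : Fin T) (i j : Fin K) =>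
    hP.integral_draw_mul_adj_mul_sq_sub_sq hU t i j
      (h.meas t j).stronglyMeasurable.aestronglyMeasurable
      ((h.ae_lossEst_mem hF t).mono fun ω hω => hω j)
      (Filter.Eventually.of_forall fun ω => hF fstar hf (I.context t ω) j) (hL t j) (hG t i j)
  have e : ∑ t, ∑ i, ∑ j, ∫ ω, I.strategy t ω i * (gstar (I.context t ω) i j *
      (I.lossEst t ω (I.context t ω) j - fstar (I.context t ω) j) ^ 2) ∂μ
      = ∫ ω, ∑ t, ∑ i, ∑ j, I.draw t i ω * ((I.graph t ω).adj i j *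
        ((I.lossEst t ω (I.context t ω) j - I.loss t ω j) ^ 2
          - (fstar (I.context t ω) j - I.loss t ω j) ^ 2)) ∂μ := by
    rw [integral_finsetSum _ fun t _ => integrable_finsetSum _ fun i _ =>
      integrable_finsetSum _ fun j _ => (key t i j).1]
    refine Finset.sum_congr rfl fun t _ => ?_
    rw [integral_finsetSum _ fun i _ => integrable_finsetSum _ fun j _ => (key t i j).1]
    refine Finset.sum_congr rfl fun i _ => ?_
    rw [integral_finsetSum _ fun j _ => (key t i j).1]
    exact Finset.sum_congr rfl fun j _ => (key t i j).2.symm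
  rw [e]
  calc _ ≤ ∫ _, RegSq ∂μ := by
        refine integral_mono_ae (integrable_finsetSum _ fun t _ => integrable_finsetSum _
          fun i _ => integrable_finsetSum _ fun j _ => (key t i j).1) (integrable_const _) ?_
        filter_upwards [h.regret] with ω hω
        -- The mean loss `fstar` is a competitor, and the squared losses are bounded below by 0.
        have hle := ciInf_le (f := fun f : F => ∑ t, ∑ j ∈ (I.graph t ω).observed (I.action t ω),
          (f.1 (I.context t ω) j - I.loss t ω j) ^ 2) ⟨0, by
            rintro _ ⟨f, rfl⟩
            exact Finset.sum_nonneg fun t _ => Finset.sum_nonneg fun j _ => sq_nonneg _⟩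
          ⟨fstar, hf⟩
        refine le_trans (le_of_eq ?_) ((sub_le_sub_left hle _).trans hω)
        rw [← Finset.sum_sub_distrib]
        refine Finset.sum_congr rfl fun t _ => ?_
        simp only [← Finset.mul_sum]
        rw [sum_draw_mul, ← Finset.sum_sub_distrib, FeedbackGraph.observed, Finset.sum_filter]
        refine Finset.sum_congr rfl fun j _ => ?_
        unfold FeedbackGraph.adj
        split_ifs <;> simp
    _ = RegSq := by simp

end Interaction

/-- Adding `(√(1 - u) - √(1 - v)) ^ 2` to the left gives equality: the right-hand side is the full
squared Hellinger distance of two Bernoulli laws, up to normalisation. -/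
theorem sq_sqrt_sub_sqrt_le {u v : ℝ} (hu : u ∈ Set.Icc (0 : ℝ) 1) (hv : v ∈ Set.Icc (0 : ℝ) 1) :
    (√u - √v) ^ 2 ≤ 2 - 2 * √(u * v) - 2 * √((1 - u) * (1 - v)) := by
  rw [Real.sqrt_mul hu.1, Real.sqrt_mul (sub_nonneg.2 hu.2)]
  have h1 := Real.sq_sqrt hu.1
  have h2 := Real.sq_sqrt hv.1
  have h3 := Real.sq_sqrt (sub_nonneg.2 hu.2)
  have h4 := Real.sq_sqrt (sub_nonneg.2 hv.2)
  nlinarith [sq_nonneg (√(1 - u) - √(1 - v))]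

/-- Change of weight from the estimated to the true graph. The slack in `u ≤ 2 v + 2 (√u - √v) ^ 2`
is `(√u - 2 √v) ^ 2`. -/
theorem mul_le_two_mul_add_sq_sqrt_sub_sqrt {u v d : ℝ} (hu : 0 ≤ u) (hv : 0 ≤ v) (hd : 0 ≤ d)
    (hd1 : d ≤ 1) : u * d ≤ 2 * (v * d) + 2 * (√u - √v) ^ 2 := by
  have h1 := Real.sq_sqrt hu
  have h2 := Real.sq_sqrt hv
  have h3 : u ≤ 2 * v + 2 * (√u - √v) ^ 2 := by nlinarith [sq_nonneg (√u - 2 * √v)]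
  nlinarith [mul_le_mul_of_nonneg_right h3 hd, mul_le_mul_of_nonneg_left hd1
    (sq_nonneg (√u - √v))]

namespace Interaction

variable {Ω : Type*} {m₀ : MeasurableSpace Ω} {𝒳 : Type*} {K T : ℕ}
  {I : Interaction Ω 𝒳 K T} {μ : Measure Ω} [MeasurableSpace 𝒳] [IsProbabilityMeasure μ]

theorem FollowsProtocol.integrable_strategy_mul_sq_sqrt_sub_sqrt (h : I.FollowsProtocol μ)
    (t : Fin T) (i : Fin K) {u v : Ω → ℝ} (hu : AEStronglyMeasurable[I.info t] u μ)
    (hv : AEStronglyMeasurable[I.info t] v μ) (hu1 : ∀ᵐ ω ∂μ, u ω ∈ Set.Icc (0 : ℝ) 1)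
    (hv1 : ∀ᵐ ω ∂μ, v ω ∈ Set.Icc (0 : ℝ) 1) :
    Integrable (fun ω => I.strategy t ω i * (√(u ω) - √(v ω)) ^ 2) μ := by
  refine h.integrable_strategy_mul t i (((Real.continuous_sqrt.comp_aestronglyMeasurable hu).sub
    (Real.continuous_sqrt.comp_aestronglyMeasurable hv)).pow 2) (C := 1) ?_
  filter_upwards [hu1, hv1] with ω h1 h2
  have h3 := Real.sqrt_nonneg (u ω)
  have h4 := Real.sqrt_nonneg (v ω)
  have h5 := Real.sqrt_le_one.2 h1.2
  have h6 := Real.sqrt_le_one.2 h2.2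
  change ‖(√(u ω) - √(v ω)) ^ 2‖ ≤ 1
  rw [Real.norm_of_nonneg (sq_nonneg _), sq_le_one_iff_abs_le_one, abs_le]
  constructor <;> linarith

/-- The log-loss regret bounds the path-wise sum of the square roots of the likelihood ratios
from below. -/
theorem LogOraclePartial.ae_le_sum_sqrt {𝒢 : Set (𝒳 → Fin K → Fin K → ℝ)} {RegLog : ℝ}
    (h : I.LogOraclePartial μ 𝒢 RegLog) (hP : I.FollowsProtocol μ)
    (h𝒢 : ∀ g ∈ 𝒢, ∀ x i j, g x i j ∈ Set.Icc (0 : ℝ) 1)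
    {gstar : 𝒳 → Fin K → Fin K → ℝ} (hg : gstar ∈ 𝒢) (hG : I.MeanGraph μ gstar) :
    ∀ᵐ ω ∂μ, ENNReal.ofReal (2 * (T * K)) ≤ ENNReal.ofReal RegLog + ∑ t, ∑ i, ∑ j,
      (2 * ENNReal.ofReal (I.draw t i ω * (I.graph t ω).adj i j *
          √(I.graphEst t ω (I.context t ω) i j / gstar (I.context t ω) i j))
        + 2 * ENNReal.ofReal (I.draw t i ω * (1 - (I.graph t ω).adj i j) *
          √((1 - I.graphEst t ω (I.context t ω) i j) / (1 - gstar (I.context t ω) i j)))) := by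
  -- Realised outcomes almost surely have positive probability under `gstar`, so the log loss of
  -- `gstar` is finite and can be cancelled in `ENNReal`.
  have hpos : ∀ᵐ ω ∂μ, ∀ t i j, 0 < if (i, j) ∈ I.graph t ω then gstar (I.context t ω) i j
      else 1 - gstar (I.context t ω) i j := by
    simp only [ae_all_iff]
    exact fun t i j => hP.ae_mean_pos t i j (hG t i j)
  have hest : ∀ᵐ ω ∂μ, ∀ t i j, I.graphEst t ω (I.context t ω) i j ∈ Set.Icc (0 : ℝ) 1 :=
    ae_all_iff.2 fun t => h.ae_graphEst_mem h𝒢 t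
  filter_upwards [h.regret, hpos, hest] with ω hreg hpos hest
  set q : Fin T → Fin K → ℝ := fun t j =>
    if (I.action t ω, j) ∈ I.graph t ω then I.graphEst t ω (I.context t ω) (I.action t ω) j
    else 1 - I.graphEst t ω (I.context t ω) (I.action t ω) j with hq
  set r : Fin T → Fin K → ℝ := fun t j =>
    if (I.action t ω, j) ∈ I.graph t ω then gstar (I.context t ω) (I.action t ω) j
    else 1 - gstar (I.context t ω) (I.action t ω) j with hr
  have hq1 : ∀ t j, q t j ≤ 1 := fun t j => by
    have := hest t (I.action t ω) j
    simp only [hq]; split_ifs <;> linarith [this.1, this.2]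
  have hr0 : ∀ t j, 0 < r t j := fun t j => hpos t (I.action t ω) j
  have hr1 : ∀ t j, r t j ≤ 1 := fun t j => by
    have := h𝒢 gstar hg (I.context t ω) (I.action t ω) j
    simp only [hr]; split_ifs <;> linarith [this.1, this.2]
  have hreg' := hreg.trans (add_le_add_left (iInf₂_le gstar hg) _)
  simp only [logLoss_adj] at hreg'
  have hsum : (∑ t, ∑ j, logInv (r t j)) + ENNReal.ofReal (2 * (T * K))
      ≤ (∑ t, ∑ j, logInv (r t j)) +
        (ENNReal.ofReal RegLog + ∑ t, ∑ j, ENNReal.ofReal (2 * √(q t j / r t j))) := by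
    have e : ENNReal.ofReal (2 * (T * K)) = ∑ _t : Fin T, ∑ _j : Fin K, (2 : ENNReal) := by
      rw [ENNReal.ofReal_mul (by norm_num), ENNReal.ofReal_mul (by positivity)]
      simp only [Finset.sum_const, Finset.card_univ, Fintype.card_fin, nsmul_eq_mul,
        ENNReal.ofReal_natCast, ENNReal.ofReal_ofNat]
      ring
    rw [e, ← Finset.sum_add_distrib, ← add_assoc]
    simp only [← Finset.sum_add_distrib]
    refine (Finset.sum_le_sum fun t _ => Finset.sum_le_sum fun j _ =>
      logInv_add_two_le (hq1 t j) (hr0 t j) (hr1 t j)).trans ?_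
    simp only [Finset.sum_add_distrib]
    exact add_le_add_left hreg' _
  have hfin : ∑ t, ∑ j, logInv (r t j) ≠ ⊤ :=
    ENNReal.sum_ne_top.2 fun t _ => ENNReal.sum_ne_top.2 fun j _ => logInv_ne_top (hr0 t j)
  refine ((ENNReal.add_le_add_iff_left hfin).1 hsum).trans (add_le_add_right ?_ _)
  refine Finset.sum_le_sum fun t _ => ?_
  refine le_trans (Finset.sum_le_sum fun j _ => ?_)
    (Finset.single_le_sum (f := fun i => ∑ j, _) (fun _ _ => zero_le)
      (Finset.mem_univ (I.action t ω)))
  rw [ENNReal.ofReal_mul (by norm_num)]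
  by_cases hj : (I.action t ω, j) ∈ I.graph t ω <;>
    simp [hq, hr, hj, draw, FeedbackGraph.adj]

/-- The log-loss regret controls the Hellinger distance of the estimated to the true graphs. -/
theorem LogOraclePartial.sum_integral_le {𝒢 : Set (𝒳 → Fin K → Fin K → ℝ)} {RegLog : ℝ}
    (h : I.LogOraclePartial μ 𝒢 RegLog) (hP : I.FollowsProtocol μ)
    (h𝒢 : ∀ g ∈ 𝒢, ∀ x i j, g x i j ∈ Set.Icc (0 : ℝ) 1)
    {gstar : 𝒳 → Fin K → Fin K → ℝ} (hg : gstar ∈ 𝒢) (hG : I.MeanGraph μ gstar) :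
    ∑ t, ∑ i, ∑ j, ∫ ω, I.strategy t ω i * (√(I.graphEst t ω (I.context t ω) i j)
      - √(gstar (I.context t ω) i j)) ^ 2 ∂μ ≤ max RegLog 0 := by
  set g : Fin T → Fin K → Fin K → Ω → ℝ := fun t i j ω => I.graphEst t ω (I.context t ω) i j
    with hgdef
  set c : Fin T → Fin K → Fin K → Ω → ℝ := fun t i j ω => gstar (I.context t ω) i j with hcdef
  have hgm : ∀ t i j, AEStronglyMeasurable[I.info t] (g t i j) μ := fun t i j =>
    (h.meas t i j).stronglyMeasurable.aestronglyMeasurable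
  have hcm : ∀ t i j, AEStronglyMeasurable[I.info t] (c t i j) μ :=
    fun t i j => hG.aestronglyMeasurable t i j
  have hg1 : ∀ t i j, ∀ᵐ ω ∂μ, g t i j ω ∈ Set.Icc (0 : ℝ) 1 := fun t i j =>
    (h.ae_graphEst_mem h𝒢 t).mono fun ω hω => hω i j
  have hc1 : ∀ t i j, ∀ᵐ ω ∂μ, c t i j ω ∈ Set.Icc (0 : ℝ) 1 := fun t i j =>
    Filter.Eventually.of_forall fun ω => h𝒢 gstar hg _ i j
  have hsqrt : ∀ {m : MeasurableSpace Ω} {u : Ω → ℝ}, AEStronglyMeasurable[m] u μ →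
      AEStronglyMeasurable[m] (fun ω => √(u ω)) μ := fun hu =>
    Real.continuous_sqrt.comp_aestronglyMeasurable hu
  have hone : ∀ t, AEStronglyMeasurable[I.info t] (fun _ : Ω => (1 : ℝ)) μ := fun t =>
    stronglyMeasurable_const.aestronglyMeasurable
  -- the three integrable quantities of an entry
  have hY : ∀ t i j, Integrable (fun ω => I.strategy t ω i * √(g t i j ω * c t i j ω)) μ :=
    fun t i j => by
      refine hP.integrable_strategy_mul t i (hsqrt ((hgm t i j).mul (hcm t i j))) (C := 1) ?_
      filter_upwards [hg1 t i j, hc1 t i j] with ω h1 h2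
      rw [Real.norm_of_nonneg (Real.sqrt_nonneg _), Real.sqrt_le_one]
      exact mul_le_one₀ h1.2 h2.1 h2.2
  have hZ : ∀ t i j, Integrable
      (fun ω => I.strategy t ω i * √((1 - g t i j ω) * (1 - c t i j ω))) μ :=
    fun t i j => by
      refine hP.integrable_strategy_mul t i
        (hsqrt (((hone t).sub (hgm t i j)).mul ((hone t).sub (hcm t i j)))) (C := 1) ?_
      filter_upwards [hg1 t i j, hc1 t i j] with ω h1 h2
      rw [Real.norm_of_nonneg (Real.sqrt_nonneg _), Real.sqrt_le_one]
      exact mul_le_one₀ (by linarith [h1.1]) (by linarith [h2.2]) (by linarith [h2.1])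
  have hX : ∀ t i j, Integrable
      (fun ω => I.strategy t ω i * (√(g t i j ω) - √(c t i j ω)) ^ 2) μ := fun t i j =>
    hP.integrable_strategy_mul_sq_sqrt_sub_sqrt t i (hgm t i j) (hcm t i j) (hg1 t i j) (hc1 t i j)
  have hp : ∀ t i, Integrable (fun ω => I.strategy t ω i) μ := fun t i => by
    simpa using hP.integrable_strategy_mul t i (hone t) (C := 1)
      (Filter.Eventually.of_forall fun ω => by simp)
  have hp0 : ∀ t i, ∀ᵐ ω ∂μ, 0 ≤ I.strategy t ω i := fun t i =>
    (hP.strategy_mem t).mono fun ω hω => hω.1 i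
  have hpsum : ∀ t, ∑ i, ∫ ω, I.strategy t ω i ∂μ = 1 := fun t => by
    rw [← integral_finsetSum _ fun i _ => hp t i,
      integral_congr_ae ((hP.strategy_mem t).mono fun ω hω => hω.2)]
    simp
  -- Hellinger distance against affinities, in expectation: a lower bound on the affinities is now
  -- enough.
  have hXle : ∀ t i j, ∫ ω, I.strategy t ω i * (√(g t i j ω) - √(c t i j ω)) ^ 2 ∂μ
      ≤ 2 * (∫ ω, I.strategy t ω i ∂μ)
        - (2 * ∫ ω, I.strategy t ω i * √(g t i j ω * c t i j ω) ∂μ)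
        - 2 * ∫ ω, I.strategy t ω i * √((1 - g t i j ω) * (1 - c t i j ω)) ∂μ := by
    intro t i j
    have hpY : Integrable (fun ω => 2 * I.strategy t ω i
        - 2 * (I.strategy t ω i * √(g t i j ω * c t i j ω))) μ :=
      ((hp t i).const_mul 2).sub ((hY t i j).const_mul 2)
    rw [← integral_const_mul, ← integral_const_mul, ← integral_const_mul,
      ← integral_sub ((hp t i).const_mul 2) ((hY t i j).const_mul 2),
      ← integral_sub hpY ((hZ t i j).const_mul 2)]
    refine integral_mono_ae (hX t i j) (hpY.sub ((hZ t i j).const_mul 2)) ?_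
    filter_upwards [hp0 t i, hg1 t i j, hc1 t i j] with ω h0 h1 h2
    have := mul_le_mul_of_nonneg_left (sq_sqrt_sub_sqrt_le h1 h2) h0
    linarith
  -- integrate the path-wise inequality
  have hmeas : ∀ t i j, AEMeasurable (fun ω => ENNReal.ofReal (I.draw t i ω *
        (I.graph t ω).adj i j * √(g t i j ω / c t i j ω))) μ ∧
      AEMeasurable (fun ω => ENNReal.ofReal (I.draw t i ω *
        (1 - (I.graph t ω).adj i j) * √((1 - g t i j ω) / (1 - c t i j ω)))) μ := by
    intro t i j
    have h1 : AEMeasurable (g t i j) μ := ((hgm t i j).mono (I.info.le t)).aemeasurable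
    have h2 : AEMeasurable (c t i j) μ := ((hcm t i j).mono (I.info.le t)).aemeasurable
    have h3 : AEMeasurable (I.draw t i) μ := (hP.measurable_draw t i).aemeasurable
    have h4 : AEMeasurable (fun ω => (I.graph t ω).adj i j) μ :=
      ((measurable_adj t i j).mono (hP.infoWithEnv_le t) le_rfl).aemeasurable
    exact ⟨((h3.mul h4).mul (h1.div h2).sqrt).ennreal_ofReal,
      ((h3.mul (h4.const_sub 1)).mul ((h1.const_sub 1).div (h2.const_sub 1)).sqrt).ennreal_ofReal⟩
  -- Likelihood ratios may be unbounded, so integration takes place in `ENNReal`; afterwards only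
  -- bounded affinities remain.
  have hint : ENNReal.ofReal (2 * (T * K)) ≤ ENNReal.ofReal RegLog + ∑ t, ∑ i, ∑ j,
      ENNReal.ofReal ((2 * ∫ ω, I.strategy t ω i * √(g t i j ω * c t i j ω) ∂μ)
        + 2 * ∫ ω, I.strategy t ω i * √((1 - g t i j ω) * (1 - c t i j ω)) ∂μ) := by
    have h1 := lintegral_mono_ae (h.ae_le_sum_sqrt hP h𝒢 hg hG)
    rw [lintegral_const, measure_univ, mul_one] at h1
    refine h1.trans (le_of_eq ?_)
    have hm : ∀ t i j, AEMeasurable (fun ω => 2 * ENNReal.ofReal (I.draw t i ω *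
        (I.graph t ω).adj i j * √(g t i j ω / c t i j ω)) + 2 * ENNReal.ofReal (I.draw t i ω *
        (1 - (I.graph t ω).adj i j) * √((1 - g t i j ω) / (1 - c t i j ω)))) μ := fun t i j =>
      ((hmeas t i j).1.const_mul 2).add ((hmeas t i j).2.const_mul 2)
    rw [lintegral_add_left measurable_const, lintegral_const, measure_univ, mul_one]
    congr 1
    rw [lintegral_finsetSum' _ fun t _ => Finset.aemeasurable_fun_sum _ fun i _ =>
      Finset.aemeasurable_fun_sum _ fun j _ => hm t i j]
    refine Finset.sum_congr rfl fun t _ => ?_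
    rw [lintegral_finsetSum' _ fun i _ => Finset.aemeasurable_fun_sum _ fun j _ => hm t i j]
    refine Finset.sum_congr rfl fun i _ => ?_
    rw [lintegral_finsetSum' _ fun j _ => hm t i j]
    refine Finset.sum_congr rfl fun j _ => ?_
    obtain ⟨k1, k2⟩ := hP.lintegral_draw_mul_adj_mul_sqrt t i j (hG t i j) (hgm t i j)
      (hc1 t i j) (hg1 t i j)
    have n1 : 0 ≤ᵐ[μ] fun ω => I.strategy t ω i * √(g t i j ω * c t i j ω) :=
      (hp0 t i).mono fun ω hω => mul_nonneg hω (Real.sqrt_nonneg _)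
    have n2 : 0 ≤ᵐ[μ] fun ω => I.strategy t ω i * √((1 - g t i j ω) * (1 - c t i j ω)) :=
      (hp0 t i).mono fun ω hω => mul_nonneg hω (Real.sqrt_nonneg _)
    rw [lintegral_add_left' ((hmeas t i j).1.const_mul 2), lintegral_const_mul'' _ (hmeas t i j).1,
      lintegral_const_mul'' _ (hmeas t i j).2, k1, k2,
      ← ofReal_integral_eq_lintegral_ofReal (hY t i j) n1,
      ← ofReal_integral_eq_lintegral_ofReal (hZ t i j) n2,
      ENNReal.ofReal_add (mul_nonneg zero_le_two (integral_nonneg_of_ae n1))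
        (mul_nonneg zero_le_two (integral_nonneg_of_ae n2)),
      ENNReal.ofReal_mul zero_le_two, ENNReal.ofReal_mul zero_le_two]
    simp
  have hnn : ∀ t i j, 0 ≤ (2 * ∫ ω, I.strategy t ω i * √(g t i j ω * c t i j ω) ∂μ)
        + 2 * ∫ ω, I.strategy t ω i * √((1 - g t i j ω) * (1 - c t i j ω)) ∂μ := fun t i j =>
    add_nonneg
      (mul_nonneg zero_le_two (integral_nonneg_of_ae
        ((hp0 t i).mono fun ω hω => mul_nonneg hω (Real.sqrt_nonneg _))))
      (mul_nonneg zero_le_two (integral_nonneg_of_ae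
        ((hp0 t i).mono fun ω hω => mul_nonneg hω (Real.sqrt_nonneg _))))
  -- `ENNReal.ofReal` truncates a negative `RegLog`, whence the maximum with 0.
  have hreal : 2 * ((T : ℝ) * K) ≤ max RegLog 0 + ∑ t, ∑ i, ∑ j,
      ((2 * ∫ ω, I.strategy t ω i * √(g t i j ω * c t i j ω) ∂μ)
        + 2 * ∫ ω, I.strategy t ω i * √((1 - g t i j ω) * (1 - c t i j ω)) ∂μ) := by
    have hs0 : 0 ≤ ∑ t, ∑ i, ∑ j,
      ((2 * ∫ ω, I.strategy t ω i * √(g t i j ω * c t i j ω) ∂μ)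
        + 2 * ∫ ω, I.strategy t ω i * √((1 - g t i j ω) * (1 - c t i j ω)) ∂μ) :=
      Finset.sum_nonneg fun t _ => Finset.sum_nonneg fun i _ => Finset.sum_nonneg fun j _ =>
        hnn t i j
    refine (ENNReal.ofReal_le_ofReal_iff (add_nonneg (le_max_right _ _) hs0)).1 ?_
    rw [ENNReal.ofReal_add (le_max_right _ _) hs0]
    refine hint.trans (add_le_add (ENNReal.ofReal_le_ofReal (le_max_left _ _)) (le_of_eq ?_))
    rw [ENNReal.ofReal_sum_of_nonneg fun t _ => Finset.sum_nonneg fun i _ =>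
      Finset.sum_nonneg fun j _ => hnn t i j]
    refine Finset.sum_congr rfl fun t _ => ?_
    rw [ENNReal.ofReal_sum_of_nonneg fun i _ => Finset.sum_nonneg fun j _ => hnn t i j]
    refine Finset.sum_congr rfl fun i _ => ?_
    rw [ENNReal.ofReal_sum_of_nonneg fun j _ => hnn t i j]
  -- The leading terms of `hXle` add up to exactly the left-hand side of `hreal`, so they cancel and
  -- only the regret is left.
  have htot : ∑ t : Fin T, ∑ i : Fin K, ∑ _j : Fin K, 2 * ∫ ω, I.strategy t ω i ∂μ
      = 2 * ((T : ℝ) * K) := by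
    simp only [Finset.sum_const, Finset.card_univ, Fintype.card_fin, nsmul_eq_mul,
      ← Finset.mul_sum, hpsum]
    ring
  have hfinal := Finset.sum_le_sum fun t (_ : t ∈ Finset.univ) =>
    Finset.sum_le_sum fun i (_ : i ∈ Finset.univ) =>
      Finset.sum_le_sum fun j (_ : j ∈ Finset.univ) => hXle t i j
  simp only [sub_sub] at hfinal
  simp only [Finset.sum_sub_distrib] at hfinal
  rw [htot] at hfinal
  linarith

end Interaction

/-! ### Expected regret for a general parameter -/

namespace Interaction

variable {Ω : Type*} {m₀ : MeasurableSpace Ω} {𝒳 : Type*} {K T : ℕ}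
  {I : Interaction Ω 𝒳 K T} {μ : Measure Ω}

section Regret

variable {fstar : 𝒳 → Fin K → ℝ}

theorem pathRegret_le [Nonempty (Fin K)] (hf : ∀ x i, fstar x i ∈ Set.Icc (0 : ℝ) 1) (ω : Ω) :
    I.pathRegret fstar ω ≤ T := by
  calc I.pathRegret fstar ω ≤ ∑ _t : Fin T, (1 : ℝ) := by
        refine Finset.sum_le_sum fun t _ => ?_
        have h1 := (hf (I.context t ω) (I.action t ω)).2
        have h2 : 0 ≤ ⨅ i, fstar (I.context t ω) i := le_ciInf fun i => (hf _ i).1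
        linarith
    _ = T := by simp

theorem MeanLoss.integrable_iInf [IsProbabilityMeasure μ] [Nonempty (Fin K)] (hL : I.MeanLoss μ fstar)
    (hf : ∀ x i, fstar x i ∈ Set.Icc (0 : ℝ) 1) (t : Fin T) :
    Integrable (fun ω => ⨅ i, fstar (I.context t ω) i) μ := by
  have hm : AEMeasurable (fun ω => ⨅ i, fstar (I.context t ω) i) μ :=
    AEMeasurable.iInf fun i => ((hL.aestronglyMeasurable t i).mono (I.info.le t)).aemeasurable
  refine Integrable.of_bound hm.aestronglyMeasurable 1 (Filter.Eventually.of_forall fun ω => ?_)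
  rw [Real.norm_of_nonneg (le_ciInf fun i => (hf _ i).1)]
  exact (ciInf_le (Set.finite_range _).bddBelow (Classical.arbitrary _)).trans (hf _ _).2

theorem ae_norm_le_one_of_mem_Icc (hf : ∀ x i, fstar x i ∈ Set.Icc (0 : ℝ) 1) (t : Fin T)
    (i : Fin K) : ∀ᵐ ω ∂μ, ‖fstar (I.context t ω) i‖ ≤ 1 :=
  Filter.Eventually.of_forall fun ω => by
    rw [Real.norm_of_nonneg (hf _ i).1]; exact (hf _ i).2

variable [MeasurableSpace 𝒳] [IsProbabilityMeasure μ]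

theorem FollowsProtocol.integrable_pathRegret [Nonempty (Fin K)] (hP : I.FollowsProtocol μ)
    (hL : I.MeanLoss μ fstar) (hf : ∀ x i, fstar x i ∈ Set.Icc (0 : ℝ) 1) :
    Integrable (I.pathRegret fstar) μ :=
  integrable_finsetSum _ fun t _ =>
    (hP.integral_apply_action t (u := fun ω => fstar (I.context t ω))
      (fun i => hL.aestronglyMeasurable t i)
      (fun i => ae_norm_le_one_of_mem_Icc hf t i)).1.sub (hL.integrable_iInf hf t)

theorem FollowsProtocol.integral_pathRegret [Nonempty (Fin K)] (hP : I.FollowsProtocol μ)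
    (hL : I.MeanLoss μ fstar) (hf : ∀ x i, fstar x i ∈ Set.Icc (0 : ℝ) 1) :
    ∫ ω, I.pathRegret fstar ω ∂μ = ∑ t, ∫ ω, (∑ i, I.strategy t ω i * fstar (I.context t ω) i
      - ⨅ i, fstar (I.context t ω) i) ∂μ := by
  have key := fun t => hP.integral_apply_action t (u := fun ω => fstar (I.context t ω))
      (fun i => hL.aestronglyMeasurable t i) (fun i => ae_norm_le_one_of_mem_Icc hf t i)
  have hi : ∀ t, Integrable (fun ω => fstar (I.context t ω) (I.action t ω)
      - ⨅ i, fstar (I.context t ω) i) μ := fun t => (key t).1.sub (hL.integrable_iInf hf t)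
  unfold pathRegret
  rw [integral_finsetSum _ fun t _ => hi t]
  refine Finset.sum_congr rfl fun t _ => ?_
  rw [integral_sub (key t).1 (hL.integrable_iInf hf t), (key t).2,
    integral_sub (integrable_finsetSum _ fun i _ => hP.integrable_strategy_mul t i
      (hL.aestronglyMeasurable t i) (ae_norm_le_one_of_mem_Icc hf t i)) (hL.integrable_iInf hf t)]

end Regret

variable [MeasurableSpace 𝒳] [IsProbabilityMeasure μ]

/-- The regret of SquareCB.UG in terms of its parameter. -/
theorem integral_pathRegret_le {F : Set (𝒳 → Fin K → ℝ)} {𝒢 : Set (𝒳 → Fin K → Fin K → ℝ)}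
    {fstar : 𝒳 → Fin K → ℝ} {gstar : 𝒳 → Fin K → Fin K → ℝ} {RegSq RegLog γ : ℝ} (hK : 2 ≤ K)
    (hF : ∀ f ∈ F, ∀ x i, f x i ∈ Set.Icc (0 : ℝ) 1)
    (h𝒢 : ∀ g ∈ 𝒢, ∀ x i j, g x i j ∈ Set.Icc (0 : ℝ) 1)
    (hne : ∀ g ∈ 𝒢, ∀ x, (graphDistributions (g x)).Nonempty)
    (hP : I.FollowsProtocol μ) (hf : fstar ∈ F) (hL : I.MeanLoss μ fstar)
    (hg : gstar ∈ 𝒢) (hG : I.MeanGraph μ gstar) (hU : I.EdgesUncorrelatedWithLosses μ)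
    (hSq : I.SqOracle μ F RegSq) (hLog : I.LogOraclePartial μ 𝒢 RegLog) (hγ : 4 ≤ γ)
    (hA : I.RunsSquareCBUG μ γ) :
    ∫ ω, I.pathRegret fstar ω ∂μ ≤ T * (14 * alphaClass 𝒢 * (1 + Real.log (K * γ)) / γ)
      + γ / 2 * (RegSq + max RegLog 0) := by
  have : Nonempty (Fin K) := ⟨⟨0, by omega⟩⟩
  have hf1 := hF fstar hf
  set B := 14 * alphaClass 𝒢 * (1 + Real.log (K * γ)) / γ with hB
  set A : Fin T → Fin K → Fin K → Ω → ℝ := fun t i j ω =>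
    I.strategy t ω i * (gstar (I.context t ω) i j *
      (I.lossEst t ω (I.context t ω) j - fstar (I.context t ω) j) ^ 2) with hAdef
  set D : Fin T → Fin K → Fin K → Ω → ℝ := fun t i j ω =>
    I.strategy t ω i * (√(I.graphEst t ω (I.context t ω) i j)
      - √(gstar (I.context t ω) i j)) ^ 2 with hDdef
  have hAi : ∀ t i j, Integrable (A t i j) μ := fun t i j => by
    refine hP.integrable_strategy_mul t i ((hG.aestronglyMeasurable t i j).mul
      (((hSq.meas t j).stronglyMeasurable.aestronglyMeasurable.sub
        (hL.aestronglyMeasurable t j)).pow 2)) (C := 1) ?_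
    filter_upwards [hSq.ae_lossEst_mem hF t] with ω hω
    have h1 := hω j
    have h2 := hf1 (I.context t ω) j
    have h3 := h𝒢 gstar hg (I.context t ω) i j
    change ‖gstar (I.context t ω) i j *
      (I.lossEst t ω (I.context t ω) j - fstar (I.context t ω) j) ^ 2‖ ≤ 1
    rw [Real.norm_of_nonneg (mul_nonneg h3.1 (sq_nonneg _))]
    refine mul_le_one₀ h3.2 (sq_nonneg _) ?_
    rw [sq_le_one_iff_abs_le_one, abs_le]
    constructor <;> linarith [h1.1, h1.2, h2.1, h2.2]
  have hDi : ∀ t i j, Integrable (D t i j) μ := fun t i j =>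
    hP.integrable_strategy_mul_sq_sqrt_sub_sqrt t i
      (hLog.meas t i j).stronglyMeasurable.aestronglyMeasurable (hG.aestronglyMeasurable t i j)
      ((hLog.ae_graphEst_mem h𝒢 t).mono fun ω hω => hω i j)
      (Filter.Eventually.of_forall fun ω => h𝒢 gstar hg _ i j)
  have hADi : ∀ t i j, Integrable (fun ω => A t i j ω + D t i j ω) μ := fun t i j =>
    (hAi t i j).add (hDi t i j)
  have hAD : ∀ t, Integrable (fun ω => ∑ i, ∑ j, (A t i j ω + D t i j ω)) μ := fun t =>
    integrable_finsetSum _ fun i _ => integrable_finsetSum _ fun j _ => hADi t i j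
  have hround : ∀ t, ∫ ω, (∑ i, I.strategy t ω i * fstar (I.context t ω) i
      - ⨅ i, fstar (I.context t ω) i) ∂μ
      ≤ B + γ / 2 * ∑ i, ∑ j, (∫ ω, A t i j ω ∂μ + ∫ ω, D t i j ω ∂μ) := by
    intro t
    have e : B + γ / 2 * ∑ i, ∑ j, (∫ ω, A t i j ω ∂μ + ∫ ω, D t i j ω ∂μ)
        = ∫ ω, (B + γ / 2 * ∑ i, ∑ j, (A t i j ω + D t i j ω)) ∂μ := by
      rw [integral_add (integrable_const _) ((hAD t).const_mul _), integral_const_mul,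
        integral_finsetSum _ fun i _ => integrable_finsetSum _ fun j _ => hADi t i j]
      simp only [integral_const, probReal_univ, one_smul]
      congr 2
      refine Finset.sum_congr rfl fun i _ => ?_
      rw [integral_finsetSum _ fun j _ => hADi t i j]
      exact Finset.sum_congr rfl fun j _ => (integral_add (hAi t i j) (hDi t i j)).symm
    rw [e]
    refine integral_mono_ae ((integrable_finsetSum _ fun i _ => hP.integrable_strategy_mul t i
      (hL.aestronglyMeasurable t i) (ae_norm_le_one_of_mem_Icc hf1 t i)).sub
        (hL.integrable_iInf hf1 t)) ((integrable_const _).add ((hAD t).const_mul _)) ?_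
    filter_upwards [hA t, hLog.mem_conv t, hLog.ae_graphEst_mem h𝒢 t, hSq.ae_lossEst_mem hF t]
      with ω hmin hconv hgm hfm
    have h1 := sum_mul_sub_iInf_le_dec (f := I.lossEst t ω) (g := I.graphEst t ω)
      (x := I.context t ω) (γ := γ) (by linarith) (fun i j => (hgm i j).1) hmin.1
      (hf1 (I.context t ω))
    have h2 := dec_le_of_isMinOn hK hγ hne hconv hmin.2
    -- Exchanging the estimated graph for the true one doubles the coefficient `γ / 4`.
    have h3 : ∑ i, I.strategy t ω i * ∑ j, I.graphEst t ω (I.context t ω) i j *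
        (I.lossEst t ω (I.context t ω) j - fstar (I.context t ω) j) ^ 2
        ≤ 2 * ∑ i, ∑ j, (A t i j ω + D t i j ω) := by
      rw [Finset.mul_sum]
      refine Finset.sum_le_sum fun i _ => ?_
      rw [Finset.mul_sum, Finset.mul_sum]
      refine Finset.sum_le_sum fun j _ => ?_
      have b1 := hfm j
      have b2 := hf1 (I.context t ω) j
      have hd : (I.lossEst t ω (I.context t ω) j - fstar (I.context t ω) j) ^ 2 ≤ 1 := by
        rw [sq_le_one_iff_abs_le_one, abs_le]
        constructor <;> linarith [b1.1, b1.2, b2.1, b2.2]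
      have := mul_le_mul_of_nonneg_left (mul_le_two_mul_add_sq_sqrt_sub_sqrt (hgm i j).1
        (h𝒢 gstar hg (I.context t ω) i j).1 (sq_nonneg _) hd) (hmin.1.1 i)
      refine this.trans (le_of_eq ?_)
      simp only [hAdef, hDdef]; ring
    have h4 := mul_le_mul_of_nonneg_left h3 (by linarith : 0 ≤ γ / 4)
    linarith
  rw [hP.integral_pathRegret hL hf1]
  refine (Finset.sum_le_sum fun t _ => hround t).trans ?_
  rw [Finset.sum_add_distrib, ← Finset.mul_sum]
  have hS := hSq.sum_integral_le hP hF hf hL hG hU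
  have hD := hLog.sum_integral_le hP h𝒢 hg hG
  simp only [Finset.sum_add_distrib, Finset.sum_const, Finset.card_univ, Fintype.card_fin,
    nsmul_eq_mul]
  exact add_le_add_right (mul_le_mul_of_nonneg_left (add_le_add hS hD) (by linarith)) _

end Interaction

/-! ### The choice of the parameter -/

/-- In use `y = α T` and `Λ = log (K T)`. With `S = √(y R)` and `s = √(y Λ / R)`, one has `S s = y
√Λ` and `s R = S √Λ`. When the maximum is 4, the second bound uses `R ≤ S`, that is, `R ≤ y`. -/
theorem parameter_bounds {y R Λ l γ : ℝ} (hy : 1 ≤ y) (hΛ : 1 / 2 ≤ Λ) (hl : 1 + Λ ≤ l)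
    (hR : 0 < R) (hRy : R ≤ y) (hγ : γ = max 4 √(y * Λ / R)) :
    y / γ ≤ 2 * √(y * R) ∧ γ * R ≤ 4 * (l * √(y * R)) := by
  obtain ⟨S, hS⟩ : ∃ S, S = √(y * R) := ⟨_, rfl⟩
  obtain ⟨s, hs⟩ : ∃ s, s = √(y * Λ / R) := ⟨_, rfl⟩
  have hS0 : 0 ≤ S := hS ▸ Real.sqrt_nonneg _
  have hs0 : 0 ≤ s := hs ▸ Real.sqrt_nonneg _
  have hSsq : S ^ 2 = y * R := by rw [hS]; exact Real.sq_sqrt (by positivity)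
  have hssq : s ^ 2 = y * Λ / R := by rw [hs]; exact Real.sq_sqrt (by positivity)
  rw [← hs] at hγ
  rw [← hS]
  have hγs : s ≤ γ := hγ ▸ le_max_right _ _
  have hγ0 : 0 < γ := lt_of_lt_of_le (by norm_num) (hγ ▸ le_max_left _ _ : 4 ≤ γ)
  have hRS : R ≤ S := by
    rw [hS]
    exact Real.le_sqrt_of_sq_le (by rw [sq]; exact mul_le_mul_of_nonneg_right hRy hR.le)
  constructor
  · rw [div_le_iff₀ hγ0]
    have hSs : (2 * S * s) ^ 2 = 4 * Λ * y ^ 2 := by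
      rw [mul_pow, mul_pow, hSsq, hssq]; field_simp; ring
    have h1 : y ≤ 2 * S * s := by
      refine (le_abs_self y).trans (abs_le_of_sq_le_sq ?_ (by positivity))
      rw [hSs]
      nlinarith [sq_nonneg y]
    exact h1.trans (mul_le_mul_of_nonneg_left hγs (by positivity))
  · have hlS : (1 + Λ) * S ≤ l * S := mul_le_mul_of_nonneg_right hl hS0
    have hsR : s * R ≤ (1 + Λ) * S := by
      have e : (s * R) ^ 2 = Λ * S ^ 2 := by rw [mul_pow, hssq, hSsq]; field_simp
      refine (le_abs_self _).trans (abs_le_of_sq_le_sq ?_ (by positivity))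
      rw [e, mul_pow]
      exact mul_le_mul_of_nonneg_right (by nlinarith) (sq_nonneg S)
    have hS1 : S ≤ l * S := le_mul_of_one_le_left hS0 (by linarith)
    rcases max_choice 4 s with h | h
    · rw [hγ, h]; linarith
    · rw [hγ, h]; linarith

/-- Since `y Λ / R ≤ (N ρ)²`, both `γ ≤ 4 N ρ` and `k γ ≤ 4 (N ρ)²` hold; then `log 4 ≤ 2` gives the
factor 3. -/
theorem one_add_log_mul_parameter_le {k N ρ y R Λ γ : ℝ} (hk : 0 < k) (hkN : k ≤ N)
    (hN : 2 ≤ N) (hρ : ρ = max 1 R⁻¹) (hyN : y ≤ N) (hΛ : 0 ≤ Λ) (hΛN : Λ ≤ N)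
    (hR : 0 < R) (hγ : γ = max 4 √(y * Λ / R)) :
    1 + Real.log (k * γ) ≤ 3 * (1 + Real.log (N * ρ)) := by
  have hρ1 : 1 ≤ ρ := hρ ▸ le_max_left _ _
  have hρR : R⁻¹ ≤ ρ := hρ ▸ le_max_right _ _
  have hNρ : N ≤ N * ρ := le_mul_of_one_le_right (by linarith) hρ1
  have hγ0 : 0 < γ := lt_of_lt_of_le (by norm_num) (hγ ▸ le_max_left _ _ : 4 ≤ γ)
  have hsN : √(y * Λ / R) ≤ N * ρ := by
    refine Real.sqrt_le_iff.2 ⟨by linarith, ?_⟩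
    rw [mul_pow, div_eq_mul_inv, sq, sq]
    exact mul_le_mul (mul_le_mul hyN hΛN hΛ (by linarith))
      (hρR.trans (le_mul_of_one_le_left (by linarith) hρ1)) (by positivity)
      (mul_nonneg (by linarith) (by linarith))
  have hγN : γ ≤ 4 * (N * ρ) := by
    rw [hγ]
    exact max_le (by linarith) (by linarith)
  have h1 : Real.log (k * γ) ≤ Real.log (4 * (N * ρ) ^ 2) := by
    refine Real.log_le_log (by positivity) ?_
    calc k * γ ≤ (N * ρ) * (4 * (N * ρ)) :=
          mul_le_mul (hkN.trans hNρ) hγN hγ0.le (by linarith)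
      _ = _ := by ring
  rw [Real.log_mul (by norm_num : (4 : ℝ) ≠ 0) (pow_ne_zero 2 (by linarith)), Real.log_pow] at h1
  have h4 : Real.log 4 ≤ 2 := by
    rw [show (4 : ℝ) = 2 ^ 2 by norm_num, Real.log_pow]
    push_cast
    linarith [Real.log_two_lt_d9]
  have h0 : 0 ≤ Real.log (N * ρ) := Real.log_nonneg (by linarith)
  push_cast at h1
  linarith

/-- The regret bound for the parameter of SquareCB.UG. -/
theorem regret_le_of_parameter {K T : ℕ} (hK : 2 ≤ K) (hT : 1 ≤ T) {a R E γ : ℝ} (ha : 1 ≤ a)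
    (haK : a ≤ K) (hR : 0 < R) (hγ : γ = max 4 √(a * T * Real.log (K * T) / R)) (hET : E ≤ T)
    (hE : E ≤ T * (14 * a * (1 + Real.log (K * γ)) / γ) + γ * R) :
    E ≤ 100 * (1 + Real.log (K * T * max 1 R⁻¹)) * √(a * T * R) := by
  have hK2 : (2 : ℝ) ≤ K := by exact_mod_cast hK
  have hT1 : (1 : ℝ) ≤ T := by exact_mod_cast hT
  have hKN : (K : ℝ) ≤ K * T := le_mul_of_one_le_right (by linarith) hT1
  have hyT : (T : ℝ) ≤ a * T := le_mul_of_one_le_left (by linarith) ha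
  have hyN : a * T ≤ K * T := mul_le_mul_of_nonneg_right haK (by linarith)
  have hΛ : 1 / 2 ≤ Real.log (K * T) := by
    have := Real.log_le_log (by norm_num) (hK2.trans hKN)
    linarith [Real.log_two_gt_d9]
  have hΛN : Real.log (K * T) ≤ K * T :=
    (Real.log_le_sub_one_of_pos (by linarith)).trans (by linarith)
  have hl : 1 + Real.log (K * T) ≤ 1 + Real.log (K * T * max 1 R⁻¹) := by
    have := Real.log_le_log (by linarith : (0 : ℝ) < K * T)
      (le_mul_of_one_le_right (by linarith : (0 : ℝ) ≤ K * T) (le_max_left 1 R⁻¹))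
    linarith
  have hlog := one_add_log_mul_parameter_le (by linarith) hKN (hK2.trans hKN) rfl
    hyN (by linarith) hΛN hR hγ
  have hS0 : 0 ≤ √(a * T * R) := Real.sqrt_nonneg _
  have hlS : √(a * T * R) ≤ (1 + Real.log (K * T * max 1 R⁻¹)) * √(a * T * R) :=
    le_mul_of_one_le_left hS0 (by linarith)
  -- If `R` exceeds `a T`, the trivial bound `T` is already below `√(a T R)`.
  rcases le_total (a * T) R with hyR | hyR
  · have h1 : (T : ℝ) ≤ √(a * T * R) := by
      refine Real.le_sqrt_of_sq_le ?_
      rw [sq]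
      exact mul_le_mul hyT (hyT.trans hyR) (by linarith) (by linarith)
    linarith
  obtain ⟨hy, hγR⟩ := parameter_bounds (hT1.trans hyT) hΛ hl hR hyR hγ
  have hγ0 : 0 < γ := lt_of_lt_of_le (by norm_num) (hγ ▸ le_max_left _ _ : 4 ≤ γ)
  have e : T * (14 * a * (1 + Real.log (K * γ)) / γ)
      = 14 * (a * T / γ) * (1 + Real.log (K * γ)) := by ring
  rw [e] at hE
  have h1 := mul_le_mul_of_nonneg_left hlog (by positivity : 0 ≤ 14 * (a * T / γ))
  have h2 := mul_le_mul_of_nonneg_right hy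
    (by linarith : 0 ≤ 1 + Real.log (K * T * max 1 R⁻¹))
  -- The constants add up to `14 · 2 · 3 + 4 = 88`.
  linarith

theorem mainTheorem1 :
    ∃ C : ℝ, 0 < C ∧
      ∀ (K T : ℕ), 1 ≤ K → 1 ≤ T →
      ∀ (𝒳 : Type*) [MeasurableSpace 𝒳] (Ω : Type*) [MeasurableSpace Ω]
        (μ : Measure Ω) [IsProbabilityMeasure μ] (I : Interaction Ω 𝒳 K T)
        (F : Set (𝒳 → Fin K → ℝ)) (𝒢 : Set (𝒳 → Fin K → Fin K → ℝ))
        (fstar : 𝒳 → Fin K → ℝ) (gstar : 𝒳 → Fin K → Fin K → ℝ) (RegSq RegLog : ℝ),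
      (∀ f ∈ F, ∀ x i, f x i ∈ Set.Icc (0 : ℝ) 1) →
      (∀ g ∈ 𝒢, ∀ x i j, g x i j ∈ Set.Icc (0 : ℝ) 1) →
      (∀ g ∈ 𝒢, ∀ x, (graphDistributions (g x)).Nonempty) →
      I.FollowsProtocol μ →
      fstar ∈ F → I.MeanLoss μ fstar →
      gstar ∈ 𝒢 → I.MeanGraph μ gstar →
      I.EdgesUncorrelatedWithLosses μ →
      I.SqOracle μ F RegSq →
      I.LogOraclePartial μ 𝒢 RegLog →
      0 < max RegSq RegLog →
      I.RunsSquareCBUG μ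
        (max 4 (Real.sqrt (alphaClass 𝒢 * T * Real.log (K * T) / max RegSq RegLog))) →
      Integrable (I.pathRegret fstar) μ ∧
      ∫ ω, I.pathRegret fstar ω ∂μ ≤
        C * (1 + Real.log (K * T * max 1 (max RegSq RegLog)⁻¹)) *
          Real.sqrt (alphaClass 𝒢 * T * max RegSq RegLog) := by
  refine ⟨100, by norm_num, ?_⟩
  intro K T hK hT 𝒳 _ Ω _ μ _ I F 𝒢 fstar gstar RegSq RegLog hF h𝒢 hne hP hf hL hg hG hU hSq hLog
    hR hA
  have : Nonempty (Fin K) := ⟨⟨0, hK⟩⟩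
  have hint := hP.integrable_pathRegret hL (hF fstar hf)
  refine ⟨hint, ?_⟩
  have hN : (1 : ℝ) ≤ K * T := one_le_mul_of_one_le_of_one_le (by exact_mod_cast hK)
    (by exact_mod_cast hT)
  rcases hK.eq_or_lt with rfl | hK2
  -- A single action has no regret. The case is separate because exploration and the lower bound on
  -- `log (K T)` need two actions.
  · have h0 : ∀ ω, I.pathRegret fstar ω = 0 := fun ω => by
      refine Finset.sum_eq_zero fun t _ => ?_
      rw [ciInf_unique, Subsingleton.elim (I.action t ω) default, sub_self]
    simp only [h0, integral_zero]
    have : 0 ≤ Real.log (((1 : ℕ) : ℝ) * T * max 1 (max RegSq RegLog)⁻¹) :=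
      Real.log_nonneg (one_le_mul_of_one_le_of_one_le hN (le_max_left _ _))
    positivity
  -- A sample point supplies a context, so the supremum in `alphaClass` is over a nonempty family.
  obtain ⟨ω⟩ := nonempty_of_isProbabilityMeasure μ
  obtain ⟨ha, haK⟩ := alphaClass_bounds hK hne hg (I.context ⟨0, hT⟩ ω)
  refine regret_le_of_parameter hK2 hT ha haK hR rfl ?_ ?_
  · calc ∫ ω, I.pathRegret fstar ω ∂μ ≤ ∫ _, (T : ℝ) ∂μ :=
          integral_mono hint (integrable_const _) (Interaction.pathRegret_le (hF fstar hf))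
      _ = T := by simp
  · refine (Interaction.integral_pathRegret_le hK2 hF h𝒢 hne hP hf hL hg hG hU hSq hLog
      (le_max_left _ _) hA).trans (add_le_add_right ?_ _)
    have h1 : RegSq + max RegLog 0 ≤ 2 * max RegSq RegLog := by
      have := le_max_left RegSq RegLog
      have : max RegLog 0 ≤ max RegSq RegLog := max_le (le_max_right _ _) hR.le
      linarith
    have h2 := mul_le_mul_of_nonneg_left h1 (by positivity :
      0 ≤ max 4 √(alphaClass 𝒢 * T * Real.log (K * T) / max RegSq RegLog) / 2)
    linarith
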